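/- Let $p\ge 1$, $d$, $N$ be integers with $N\ge\max(d,p)$, let $\Phi\in\mathbb R^{d\times N}$ have full rank, let $D$ be an $N\times N$ diagonal matrix with strictly positive diagonal entries, and let $\nu>2p$ be real; put $\nu'=\nu-p-1$. For $Y\in\mathbb R^{p\times N}$, $M\in\mathbb R^{p\times d}$, $K\in\mathbb R^{d\times d}$ symmetric positive semidefinite and $\Psi\in\mathbb R^{p\times p}$ symmetric positive definite, let $$\Omega=D+\Phi^\top K\Phi,\qquad E=Y-M\Phi,\qquad H=\Psi+E\,\Omega^{-1}E^\top,\qquad C=\frac{\Gamma_p\big(\tfrac{\nu'+N}{2}\big)}{\Gamma_p\big(\tfrac{\nu'}{2}\big)\,\pi^{Np/2}},$$ where $\Gamma_p$ is the multivariate gamma function, and $$L(M,K,\Psi)=-\ln C-\tfrac{\nu'}{2}\ln|\Psi|+\tfrac p2\ln|\Omega|+\tfrac{\nu'+N}{2}\ln|H| .$$ For $K$ positive definite, $L$ is the negative logarithm of the evidence, that is, of the density at $Y$ $$C\,|\Psi|^{-N/2}|\Omega|^{-p/2}\big|I_p+\Psi^{-1}E\,\Omega^{-1}E^\top\big|^{-(\nu'+N)/2}$$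 of the matrix-T probability distribution with mean $M\Phi$, row covariance $\Psi$, column covariance $\Omega$ and $\nu-2p$ degrees of freedom. Put $$\hat M=YD^{-1}\Phi^\top(\Phi D^{-1}\Phi^\top)^{-1},\qquad \hat\Psi=\frac{\nu'}{N}\,YD^{-1/2}PD^{-1/2}Y^\top,\qquad P=I_N-(\Phi D^{-1/2})^{\dagger}\,\Phi D^{-1/2},$$ where $\dagger$ denotes the Moore–Penrose inverse; $P$ is the orthogonal projector onto the kernel of $\Phi D^{-1/2}$. Then: 1. For every $Y$, every positive semidefinite $K$ and every positive definite $\Psi$, $\hat M$ is the unique minimizer of $M\mapsto L(M,K,\Psi)$. If $Y$ is such that $\hat\Psi$ is positive definite (which, when $N\ge d+p$, holds almost surely under the evidence with any parameters $M,K,\Psi$, $K$ and $\Psi$ positive definite), then for every positive semidefinite $K$ the pair $(\hat M,\hat\Psi)$, which does not depend on $K$, is the unique minimizer of $(M,\Psi)\mapsto L(M,K,\Psi)$ over all $M$ and all positive definite $\Psi$. Consequently, with $K,\Psi$ ranging over positive definite matrices, $$\inf_{M,K,\Psi}L(M,K,\Psi)=\inf_{K}L(\hat M,K,\hat\Psi)=L(\hat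 M,0,\hat\Psi).$$ 2. If $\nu>2p+2$ and $Y$ is distributed according to the evidence with parameters $M,K,\Psi$ ($K,\Psi$ positive definite), then $\hat\Psi$ is integrable and $$\mathbb E[\hat\Psi]=\frac{N-d}{N}\cdot\frac{\nu'}{\nu'-p-1}\,\Psi .$$ 3. If $\hat\Psi$ is positive definite, then $K\mapsto L(\hat M,K,\hat\Psi)$ is concave on the cone of positive semidefinite matrices and strictly increasing in the Löwner order: $L(\hat M,K',\hat\Psi)<L(\hat M,K,\hat\Psi)$ whenever $K'$ and $K-K'$ are positive semidefinite and $K\ne K'$. In particular the singular point $\hat K=0$ is its unique global minimizer over the positive semidefinite matrices, and $(\hat M,0,\hat\Psi)$ is the unique global minimizer of $L$ over all $M$, all positive semidefinite $K$ and all positive definite $\Psi$. -/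

import Mathlib

open MeasureTheory Matrix

noncomputable section

namespace BLL

/-- The noise covariance `D = diag(δ₁, …, δ_N)`, where `δ i = σ²(x i)`. -/
def noiseCov {N : ℕ} (δ : Fin N → ℝ) : Matrix (Fin N) (Fin N) ℝ :=
  Matrix.diagonal δ

/-- The matrix `D^{-1/2}`. -/
def noiseInvSqrt {N : ℕ} (δ : Fin N → ℝ) : Matrix (Fin N) (Fin N) ℝ :=
  Matrix.diagonal fun i => (Real.sqrt (δ i))⁻¹

/-- The matrix `Ω(K) = D + Φᵀ K Φ`. -/
def Om {d N : ℕ} (Φ : Matrix (Fin d) (Fin N) ℝ) (δ : Fin N → ℝ)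
    (K : Matrix (Fin d) (Fin d) ℝ) : Matrix (Fin N) (Fin N) ℝ :=
  noiseCov δ + Φᵀ * K * Φ

/-- The residual `E = Y - M Φ`. -/
def resid {p d N : ℕ} (Φ : Matrix (Fin d) (Fin N) ℝ) (Y : Matrix (Fin p) (Fin N) ℝ)
    (M : Matrix (Fin p) (Fin d) ℝ) : Matrix (Fin p) (Fin N) ℝ :=
  Y - M * Φ

/-- The matrix `H = Ψ + E Ω⁻¹ Eᵀ`. -/
def Hmat {p d N : ℕ} (Φ : Matrix (Fin d) (Fin N) ℝ) (δ : Fin N → ℝ)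
    (Y : Matrix (Fin p) (Fin N) ℝ) (M : Matrix (Fin p) (Fin d) ℝ)
    (K : Matrix (Fin d) (Fin d) ℝ) (Ψ : Matrix (Fin p) (Fin p) ℝ) : Matrix (Fin p) (Fin p) ℝ :=
  Ψ + resid Φ Y M * (Om Φ δ K)⁻¹ * (resid Φ Y M)ᵀ

/-- The multivariate gamma function
`Γ_p(a) = π^{p(p-1)/4} ∏_{j=1}^{p} Γ(a - (j-1)/2)`. -/
def multiGamma (p : ℕ) (a : ℝ) : ℝ :=
  Real.pi ^ ((p : ℝ) * ((p : ℝ) - 1) / 4) * ∏ j : Fin p, Real.Gamma (a - (j : ℝ) / 2)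

/-- The reduced number of degrees of freedom `ν' = ν - p - 1`. -/
def nuP (p : ℕ) (ν : ℝ) : ℝ := ν - p - 1

/-- The constant `C = Γ_p((ν' + N)/2) / (Γ_p(ν'/2) π^{Np/2})`. -/
def normConst (p N : ℕ) (ν : ℝ) : ℝ :=
  multiGamma p ((nuP p ν + N) / 2) /
    (multiGamma p (nuP p ν / 2) * Real.pi ^ ((N : ℝ) * (p : ℝ) / 2))

/-- The evidential loss
`L(M, K, Ψ) = -ln C - (ν'/2) ln|Ψ| + (p/2) ln|Ω| + ((ν' + N)/2) ln|H|`. -/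
def loss {p d N : ℕ} (Φ : Matrix (Fin d) (Fin N) ℝ) (δ : Fin N → ℝ) (ν : ℝ)
    (Y : Matrix (Fin p) (Fin N) ℝ) (M : Matrix (Fin p) (Fin d) ℝ)
    (K : Matrix (Fin d) (Fin d) ℝ) (Ψ : Matrix (Fin p) (Fin p) ℝ) : ℝ :=
  -Real.log (normConst p N ν) - nuP p ν / 2 * Real.log Ψ.det
    + (p : ℝ) / 2 * Real.log (Om Φ δ K).det
    + (nuP p ν + N) / 2 * Real.log (Hmat Φ δ Y M K Ψ).det

/-- The density at `T` of the matrix-T distribution on `p × n` matrices with mean `M₀`, row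
covariance `S`, column covariance `W` and `κ` degrees of freedom. -/
def matrixTPDF {p n : ℕ} (M₀ : Matrix (Fin p) (Fin n) ℝ) (S : Matrix (Fin p) (Fin p) ℝ)
    (W : Matrix (Fin n) (Fin n) ℝ) (κ : ℝ) (T : Matrix (Fin p) (Fin n) ℝ) : ℝ :=
  multiGamma p ((κ + n + p - 1) / 2) /
      (multiGamma p ((κ + p - 1) / 2) * Real.pi ^ ((n : ℝ) * (p : ℝ) / 2))
    * S.det ^ (-((n : ℝ) / 2)) * W.det ^ (-((p : ℝ) / 2))
    * (1 + S⁻¹ * (T - M₀) * W⁻¹ * (T - M₀)ᵀ).det ^ (-((κ + n + p - 1) / 2))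

/-- The matrix-T distribution, as a measure with density with respect to Lebesgue measure on the
space of `p × n` arrays of real numbers. -/
def matrixT {p n : ℕ} (M₀ : Matrix (Fin p) (Fin n) ℝ) (S : Matrix (Fin p) (Fin p) ℝ)
    (W : Matrix (Fin n) (Fin n) ℝ) (κ : ℝ) : Measure (Fin p → Fin n → ℝ) :=
  (volume : Measure (Fin p → Fin n → ℝ)).withDensity
    fun T => ENNReal.ofReal (matrixTPDF M₀ S W κ (Matrix.of T))

/-- The evidence, that is, the law of `Y` given the hyperparameters `(M, K, Ψ)`: matrix-T with
mean `M Φ`, row covariance `Ψ`, column covariance `Ω(K)` and `ν - 2p` degrees of freedom. -/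
def evidence {p d N : ℕ} (Φ : Matrix (Fin d) (Fin N) ℝ) (δ : Fin N → ℝ) (ν : ℝ)
    (M : Matrix (Fin p) (Fin d) ℝ) (K : Matrix (Fin d) (Fin d) ℝ)
    (Ψ : Matrix (Fin p) (Fin p) ℝ) : Measure (Fin p → Fin N → ℝ) :=
  matrixT (M * Φ) Ψ (Om Φ δ K) (ν - 2 * p)

/-- `X` is a Moore–Penrose generalized inverse of the real matrix `A`. -/
structure IsMoorePenrose {m n : ℕ} (A : Matrix (Fin m) (Fin n) ℝ)
    (X : Matrix (Fin n) (Fin m) ℝ) : Prop where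
  mul_inv_mul : A * X * A = A
  inv_mul_inv : X * A * X = X
  symm_left : (A * X)ᵀ = A * X
  symm_right : (X * A)ᵀ = X * A

/-- A matrix has at most one Moore–Penrose inverse. -/
theorem IsMoorePenrose.unique {m n : ℕ} {A : Matrix (Fin m) (Fin n) ℝ}
    {X Z : Matrix (Fin n) (Fin m) ℝ} (hX : IsMoorePenrose A X) (hZ : IsMoorePenrose A Z) :
    X = Z := by
  have h1 : X * A = Z * A := by
    have e : Z * A * (X * A) = Z * A := by
      rw [Matrix.mul_assoc, ← Matrix.mul_assoc A X A, hX.mul_inv_mul]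
    have e' : X * A * (Z * A) = X * A := by
      rw [Matrix.mul_assoc, ← Matrix.mul_assoc A Z A, hZ.mul_inv_mul]
    calc X * A = (X * A)ᵀ := hX.symm_right.symm
      _ = (X * A * (Z * A))ᵀ := by rw [e']
      _ = Z * A * (X * A) := by rw [Matrix.transpose_mul, hX.symm_right, hZ.symm_right]
      _ = Z * A := e
  have h2 : A * X = A * Z := by
    have e : A * Z * (A * X) = A * X := by
      rw [← Matrix.mul_assoc, hZ.mul_inv_mul]
    have e' : A * X * (A * Z) = A * Z := by
      rw [← Matrix.mul_assoc, hX.mul_inv_mul]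
    calc A * X = (A * X)ᵀ := hX.symm_left.symm
      _ = (A * Z * (A * X))ᵀ := by rw [e]
      _ = A * X * (A * Z) := by rw [Matrix.transpose_mul, hX.symm_left, hZ.symm_left]
      _ = A * Z := e'
  calc X = X * A * X := hX.inv_mul_inv.symm
    _ = Z * A * Z := by rw [h1, Matrix.mul_assoc, h2, ← Matrix.mul_assoc]
    _ = Z := hZ.inv_mul_inv

/-- The Moore–Penrose inverse `A†`. -/
def pinv {m n : ℕ} (A : Matrix (Fin m) (Fin n) ℝ) : Matrix (Fin n) (Fin m) ℝ :=
  Classical.epsilon (IsMoorePenrose A)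

/-- The matrix `P = I - (Φ D^{-1/2})† Φ D^{-1/2}`. -/
def proj {d N : ℕ} (Φ : Matrix (Fin d) (Fin N) ℝ) (δ : Fin N → ℝ) :
    Matrix (Fin N) (Fin N) ℝ :=
  1 - pinv (Φ * noiseInvSqrt δ) * (Φ * noiseInvSqrt δ)

/-- The weighted least squares solution `M̂ = Y D⁻¹ Φᵀ (Φ D⁻¹ Φᵀ)⁻¹`. -/
def Mhat {p d N : ℕ} (Φ : Matrix (Fin d) (Fin N) ℝ) (δ : Fin N → ℝ)
    (Y : Matrix (Fin p) (Fin N) ℝ) : Matrix (Fin p) (Fin d) ℝ :=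
  Y * (noiseCov δ)⁻¹ * Φᵀ * (Φ * (noiseCov δ)⁻¹ * Φᵀ)⁻¹

/-- The estimator `Ψ̂ = (ν'/N) Y D^{-1/2} P D^{-1/2} Yᵀ`. -/
def Psihat {p d N : ℕ} (Φ : Matrix (Fin d) (Fin N) ℝ) (δ : Fin N → ℝ) (ν : ℝ)
    (Y : Matrix (Fin p) (Fin N) ℝ) : Matrix (Fin p) (Fin p) ℝ :=
  (nuP p ν / N) • (Y * noiseInvSqrt δ * proj Φ δ * noiseInvSqrt δ * Yᵀ)

end BLL

end

/-! Everything turns on the matrix Q = D^{-1/2} P D^{-1/2} (`precisionProj`), which satisfies QΦᵀ =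
0 and QDQ = Q. The first identity gives QΩ = QD for every K. Since the residual at M̂ is YQD, this
yields EΩ⁻¹ = YQ and H = Ψ + YQYᵀ, both free of K. For a general M the cross terms vanish and H
exceeds this matrix by FΩ⁻¹Fᵀ with F = (M̂ - M)Φ.

The optimization then rests on ln det. The tangent inequality ln|A| ≤ ln|B| + tr(B⁻¹A) - n, strict
for A ≠ B, comes from ln x ≤ x - 1 on eigenvalues and gives both strict monotonicity and strict
concavity. Monotonicity singles out M̂. Concavity applied to Ψ + YQYᵀ singles out Ψ̂
(`log_det_profile_lt`). What remains of K is (p/2) ln|Ω|, with Ω affine in K: concave, strictly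
increasing, hence smallest at K = 0.

For the probabilistic claims, a matrix-T law is an affine image of the standard one, whose density
is a power of |I + ZᵀZ|. Integrating out one row at a time gives the normalization and the second
moment of an entry; sign changes of rows and columns kill the mixed moments. As QΦᵀ = 0 removes the
mean MΦ, the expectation of YQYᵀ is Ψ times tr(QΩ) = N - d over (degrees of freedom - 2). Almost
sure definiteness holds because |YQYᵀ| has finitely many zeros on each line in a suitable direction.
-/

noncomputable section

namespace BLL

/-! ### Convexity and monotonicity of the log-determinant -/

section LogDet

variable {n : Type*} [Fintype n] [DecidableEq n]

theorem exists_eq_mul_transpose_of_posDef {A : Matrix n n ℝ} (hA : A.PosDef) :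
    ∃ G : Matrix n n ℝ, IsUnit G.det ∧ A = G * Gᵀ := by
  open scoped MatrixOrder in
  obtain ⟨y, hy⟩ := CStarAlgebra.nonneg_iff_eq_star_mul_self.mp hA.posSemidef.nonneg
  have hy' : A = yᵀ * yᵀᵀ := by
    rw [hy, star_eq_conjTranspose, conjTranspose_eq_transpose_of_trivial, transpose_transpose]
  refine ⟨yᵀ, ?_, hy'⟩
  have h := hA.det_pos
  rw [hy', det_mul] at h
  exact isUnit_iff_ne_zero.2 fun h0 => by simp [h0] at h

/-- Sum ln λ ≤ λ - 1 over the eigenvalues; it is strict at some eigenvalue, since by the spectral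
theorem only the identity has all of them equal to 1. -/
theorem log_det_lt_trace_sub_card {A : Matrix n n ℝ} (hA : A.PosDef) (h1 : A ≠ 1) :
    Real.log A.det < A.trace - Fintype.card n := by
  have hH := hA.isHermitian
  have hdet : A.det = ∏ i, hH.eigenvalues i := by simpa using hH.det_eq_prod_eigenvalues
  have htr : A.trace = ∑ i, hH.eigenvalues i := by simpa using hH.trace_eq_sum_eigenvalues
  have hpos := hA.eigenvalues_pos
  have hne : ∃ i, hH.eigenvalues i ≠ 1 := by
    by_contra! hcon
    apply h1
    have hs := hH.spectral_theorem
    have hd : diagonal ((RCLike.ofReal : ℝ → ℝ) ∘ hH.eigenvalues) = 1 := by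
      rw [← diagonal_one]; congr 1; funext i; simp [hcon i]
    rw [hd, map_one] at hs
    exact hs
  rw [hdet, htr, Real.log_prod (fun i _ => (hpos i).ne')]
  have : ∑ i, hH.eigenvalues i - (Fintype.card n : ℝ) = ∑ i, (hH.eigenvalues i - 1) := by
    simp
  rw [this]
  obtain ⟨i, hi⟩ := hne
  exact Finset.sum_lt_sum (fun j _ => Real.log_le_sub_one_of_pos (hpos j))
    ⟨i, Finset.mem_univ _, Real.log_lt_sub_one_of_pos (hpos i) hi⟩

/-- The strict tangent inequality at B. Writing B = GGᵀ and replacing A by G⁻¹AG⁻ᵀ reduces it to B =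
1. -/
theorem log_det_lt_add_trace {A B : Matrix n n ℝ} (hA : A.PosDef) (hB : B.PosDef) (h : A ≠ B) :
    Real.log A.det < Real.log B.det + ((B⁻¹ * A).trace - Fintype.card n) := by
  obtain ⟨G, hG, rfl⟩ := exists_eq_mul_transpose_of_posDef hB
  have hGi : IsUnit (G⁻¹).det := by simpa using hG
  have hGt : IsUnit Gᵀ.det := by simpa using hG
  have hX : (G⁻¹ * A * (G⁻¹)ᵀ).PosDef := by
    have := hA.mul_mul_conjTranspose_same (B := G⁻¹)
      (vecMul_injective_iff_isUnit.2 ((isUnit_iff_isUnit_det _).2 hGi))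
    rwa [conjTranspose_eq_transpose_of_trivial] at this
  have hne : G⁻¹ * A * (G⁻¹)ᵀ ≠ 1 := by
    intro h1
    apply h
    have h2 : G * (G⁻¹ * A * (G⁻¹)ᵀ) * Gᵀ = G * Gᵀ := by rw [h1, Matrix.mul_one]
    rw [← h2, transpose_nonsing_inv, ← Matrix.mul_assoc, ← Matrix.mul_assoc,
      mul_nonsing_inv _ hG, Matrix.one_mul, Matrix.mul_assoc, nonsing_inv_mul _ hGt,
      Matrix.mul_one]
  have key := log_det_lt_trace_sub_card hX hne
  have htr : (G⁻¹ * A * (G⁻¹)ᵀ).trace = ((G * Gᵀ)⁻¹ * A).trace := by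
    rw [trace_mul_comm, ← Matrix.mul_assoc, Matrix.mul_inv_rev, transpose_nonsing_inv]
  have hdet : Real.log (G⁻¹ * A * (G⁻¹)ᵀ).det = Real.log A.det - Real.log (G * Gᵀ).det := by
    have hG0 : G.det ≠ 0 := hG.ne_zero
    have h1 : (G⁻¹ * A * (G⁻¹)ᵀ).det = A.det / (G * Gᵀ).det := by
      simp only [det_mul, det_transpose, det_nonsing_inv, Ring.inverse_eq_inv']
      field_simp
    rw [h1, Real.log_div hA.det_pos.ne' hB.det_pos.ne']
  rw [htr, hdet] at key
  linarith

theorem log_det_le_add_trace {A B : Matrix n n ℝ} (hA : A.PosDef) (hB : B.PosDef) :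
    Real.log A.det ≤ Real.log B.det + ((B⁻¹ * A).trace - Fintype.card n) := by
  by_cases h : A = B
  · subst h
    rw [nonsing_inv_mul _ ((isUnit_iff_isUnit_det _).1 hA.isUnit)]
    simp
  · exact (log_det_lt_add_trace hA hB h).le

/-- Strict concavity: average the tangent inequalities taken at X = sA + tB. The trace terms cancel
because s tr(X⁻¹A) + t tr(X⁻¹B) = n. -/
theorem log_det_add_smul_lt {A B : Matrix n n ℝ} (hA : A.PosDef) (hB : B.PosDef) (h : A ≠ B)
    {s t : ℝ} (hs : 0 < s) (ht : 0 < t) (hst : s + t = 1) :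
    s * Real.log A.det + t * Real.log B.det < Real.log (s • A + t • B).det := by
  have hX : (s • A + t • B).PosDef := (hA.smul hs).add (hB.smul ht)
  have hne : A ≠ s • A + t • B := by
    intro he
    apply h
    have h1 : t • A = t • B := by
      have : s • A + t • A = s • A + t • B := by rw [← add_smul, hst, one_smul]; exact he
      exact add_left_cancel this
    exact smul_right_injective _ ht.ne' h1
  have h1 := mul_lt_mul_of_pos_left (log_det_lt_add_trace hA hX hne) hs
  have h2 := mul_le_mul_of_nonneg_left (log_det_le_add_trace hB hX) ht.le
  have h3 : s * ((s • A + t • B)⁻¹ * A).trace + t * ((s • A + t • B)⁻¹ * B).trace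
      = Fintype.card n := by
    have : ((s • A + t • B)⁻¹ * (s • A + t • B)).trace = Fintype.card n := by
      rw [nonsing_inv_mul _ ((isUnit_iff_isUnit_det _).1 hX.isUnit)]
      simp
    rw [← this, Matrix.mul_add, trace_add, Matrix.mul_smul, Matrix.mul_smul, trace_smul,
      trace_smul, smul_eq_mul, smul_eq_mul]
  have h4 : t = 1 - s := by linarith
  subst h4
  nlinarith

theorem log_det_concave {A B : Matrix n n ℝ} (hA : A.PosDef) (hB : B.PosDef)
    {s t : ℝ} (hs : 0 ≤ s) (ht : 0 ≤ t) (hst : s + t = 1) :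
    s * Real.log A.det + t * Real.log B.det ≤ Real.log (s • A + t • B).det := by
  rcases hs.eq_or_lt with rfl | hs
  · simp_all
  rcases ht.eq_or_lt with rfl | ht
  · simp_all
  by_cases h : A = B
  · subst h
    rw [← add_smul, ← add_mul, hst, one_smul, one_mul]
  · exact (log_det_add_smul_lt hA hB h hs ht hst).le

/-- The tangent inequality at X = A + B leaves -tr(X⁻¹B), which is nonpositive as X⁻¹ is positive
definite. -/
theorem log_det_lt_log_det_add {A B : Matrix n n ℝ} (hA : A.PosDef) (hB : B.PosSemidef)
    (h : B ≠ 0) : Real.log A.det < Real.log (A + B).det := by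
  have hX : (A + B).PosDef := hA.add_posSemidef hB
  have h1 := log_det_lt_add_trace hA hX (by simpa using h)
  have hXi := hX.inv
  have h2 : 0 ≤ ((A + B)⁻¹ * B).trace := by
    obtain ⟨G, -, hG⟩ := exists_eq_mul_transpose_of_posDef hXi
    rw [hG, Matrix.mul_assoc, trace_mul_comm]
    have := hB.conjTranspose_mul_mul_same G
    rw [conjTranspose_eq_transpose_of_trivial] at this
    exact this.trace_nonneg
  have h3 : ((A + B)⁻¹ * A).trace + ((A + B)⁻¹ * B).trace = Fintype.card n := by
    rw [← trace_add, ← Matrix.mul_add, nonsing_inv_mul _ ((isUnit_iff_isUnit_det _).1 hX.isUnit)]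
    simp
  linarith

/-- The function `Ψ ↦ (α + β) ln |Ψ + S| - α ln |Ψ|` is minimal exactly at `Ψ = (α / β) S`. -/
theorem log_det_profile_lt {S Ψ : Matrix n n ℝ} {α β : ℝ} (hα : 0 < α) (hβ : 0 < β)
    (hS : S.PosDef) (hΨ : Ψ.PosDef) (h : Ψ ≠ (α / β) • S) :
    -α * Real.log ((α / β) • S).det + (α + β) * Real.log ((α / β) • S + S).det <
      -α * Real.log Ψ.det + (α + β) * Real.log (Ψ + S).det := by
  have hab : 0 < α + β := by positivity
  -- Weights with Ψ + S = s(s⁻¹Ψ) + t(t⁻¹S). In strict concavity, equality would force s⁻¹Ψ = t⁻¹S,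
  -- that is Ψ = (α/β)S.
  set s := α / (α + β) with hs
  set t := β / (α + β) with ht
  have hs0 : 0 < s := by positivity
  have ht0 : 0 < t := by positivity
  have hst : s + t = 1 := by rw [hs, ht]; field_simp
  have hΨ' : (s⁻¹ • Ψ).PosDef := hΨ.smul (by positivity)
  have hS' : (t⁻¹ • S).PosDef := hS.smul (by positivity)
  have hne : s⁻¹ • Ψ ≠ t⁻¹ • S := by
    intro he
    apply h
    have := congrArg (s • ·) he
    simp only [smul_smul] at this
    rw [mul_inv_cancel₀ hs0.ne', one_smul] at this
    rw [this]
    congr 1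
    rw [hs, ht]; field_simp
  have key := log_det_add_smul_lt hΨ' hS' hne hs0 ht0 hst
  rw [smul_smul, smul_smul, mul_inv_cancel₀ hs0.ne', mul_inv_cancel₀ ht0.ne', one_smul,
    one_smul] at key
  have e1 : (α / β) • S + S = t⁻¹ • S := by
    nth_rewrite 2 [← one_smul ℝ S]
    rw [← add_smul]; congr 1; rw [ht]; field_simp
  have e2 : (α / β) • S = s • t⁻¹ • S := by
    rw [smul_smul]; congr 1; rw [hs, ht]; field_simp
  have l1 : Real.log (s⁻¹ • Ψ).det = -Fintype.card n * Real.log s + Real.log Ψ.det := by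
    rw [det_smul, Real.log_mul (by positivity) hΨ.det_pos.ne', Real.log_pow, Real.log_inv]; ring
  have l2 : Real.log (s • t⁻¹ • S).det
      = Fintype.card n * Real.log s + Real.log (t⁻¹ • S).det := by
    rw [det_smul, Real.log_mul (by positivity) hS'.det_pos.ne', Real.log_pow]
  rw [e1, e2, l2]
  rw [l1] at key
  have h1 : α = s * (α + β) := by rw [hs]; field_simp
  have h2 : β = t * (α + β) := by rw [ht]; field_simp
  have h3 := mul_lt_mul_of_pos_left key hab
  linear_combination h3 + (Real.log Ψ.det - Fintype.card n * Real.log s) * h1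
    + Real.log (t⁻¹ • S).det * h2

end LogDet

/-! ### Moore–Penrose inverse at full row rank, and positive definite matrices -/

section MoorePenrose

variable {m n : ℕ}

theorem isMoorePenrose_of_isUnit {A : Matrix (Fin m) (Fin n) ℝ} (hA : IsUnit (A * Aᵀ).det) :
    IsMoorePenrose A (Aᵀ * (A * Aᵀ)⁻¹) where
  mul_inv_mul := by rw [← Matrix.mul_assoc, mul_nonsing_inv _ hA, Matrix.one_mul]
  inv_mul_inv := by
    rw [Matrix.mul_assoc, ← Matrix.mul_assoc A, mul_nonsing_inv _ hA, Matrix.mul_one]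
  symm_left := by rw [← Matrix.mul_assoc, mul_nonsing_inv _ hA, transpose_one]
  symm_right := by
    rw [transpose_mul, transpose_mul, transpose_transpose, transpose_nonsing_inv, transpose_mul,
      transpose_transpose, Matrix.mul_assoc]

theorem IsMoorePenrose.pinv_eq {A : Matrix (Fin m) (Fin n) ℝ} {X : Matrix (Fin n) (Fin m) ℝ}
    (h : IsMoorePenrose A X) : pinv A = X :=
  (Classical.epsilon_spec (p := IsMoorePenrose A) ⟨X, h⟩).unique h

theorem vecMul_injective_of_rank_eq {A : Matrix (Fin m) (Fin n) ℝ} (h : A.rank = m) :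
    Function.Injective A.vecMul := by
  rw [vecMul_injective_iff, linearIndependent_iff_card_eq_finrank_span, Fintype.card_fin,
    Set.finrank, ← rank_eq_finrank_span_row, h]

theorem posDef_mul_transpose {A : Matrix (Fin m) (Fin n) ℝ} (h : Function.Injective A.vecMul) :
    (A * Aᵀ).PosDef := by
  have := PosDef.mul_conjTranspose_self A h
  rwa [conjTranspose_eq_transpose_of_trivial] at this

end MoorePenrose

theorem isUnit_det_of_posDef {n : Type*} [Fintype n] [DecidableEq n] {A : Matrix n n ℝ}
    (hA : A.PosDef) : IsUnit A.det :=
  isUnit_iff_ne_zero.2 hA.det_pos.ne'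

theorem posSemidef_mul_mul_transpose {m n : Type*} [Fintype m] [Fintype n] {A : Matrix n n ℝ}
    (hA : A.PosSemidef) (B : Matrix m n ℝ) : (B * A * Bᵀ).PosSemidef := by
  have := hA.mul_mul_conjTranspose_same B
  rwa [conjTranspose_eq_transpose_of_trivial] at this

theorem transpose_eq_of_posSemidef {n : Type*} {A : Matrix n n ℝ} (hA : A.PosSemidef) :
    Aᵀ = A := by
  have := hA.isHermitian.eq
  rwa [conjTranspose_eq_transpose_of_trivial] at this

/-- With A = GGᵀ the product is (BG)(BG)ᵀ, which vanishes only if BG does, and G is invertible. -/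
theorem eq_zero_of_mul_mul_transpose_eq_zero {m n : Type*} [Fintype m] [Fintype n]
    [DecidableEq n] {A : Matrix n n ℝ} (hA : A.PosDef) {B : Matrix m n ℝ}
    (h : B * A * Bᵀ = 0) : B = 0 := by
  obtain ⟨G, hG, rfl⟩ := exists_eq_mul_transpose_of_posDef hA
  have h1 : (B * G) * (B * G)ᴴ = 0 := by
    rw [conjTranspose_eq_transpose_of_trivial, transpose_mul, ← h]
    simp only [Matrix.mul_assoc]
  have h2 := self_mul_conjTranspose_eq_zero.1 h1
  calc B = B * G * G⁻¹ := by rw [Matrix.mul_assoc, mul_nonsing_inv _ hG, Matrix.mul_one]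
    _ = 0 := by rw [h2, Matrix.zero_mul]

/-! ### The noise covariance and its inverse square root -/

section Noise

variable {N : ℕ} {δ : Fin N → ℝ}

theorem transpose_noiseInvSqrt : (noiseInvSqrt δ)ᵀ = noiseInvSqrt δ := diagonal_transpose _

theorem noiseInvSqrt_mul_noiseCov_mul (hδ : ∀ i, 0 < δ i) :
    noiseInvSqrt δ * noiseCov δ * noiseInvSqrt δ = 1 := by
  rw [noiseInvSqrt, noiseCov, diagonal_mul_diagonal, diagonal_mul_diagonal, ← diagonal_one]
  congr 1
  funext i
  have h := Real.mul_self_sqrt (hδ i).le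
  have h0 : Real.sqrt (δ i) ≠ 0 := (Real.sqrt_pos.2 (hδ i)).ne'
  field_simp
  nlinarith

theorem noiseCov_mul_inv_sq (hδ : ∀ i, 0 < δ i) :
    noiseCov δ * (noiseInvSqrt δ * noiseInvSqrt δ) = 1 := by
  rw [← noiseInvSqrt_mul_noiseCov_mul hδ, noiseInvSqrt, noiseCov]
  simp only [diagonal_mul_diagonal]
  congr 1
  funext i
  ring

theorem inv_sq_mul_noiseCov (hδ : ∀ i, 0 < δ i) :
    noiseInvSqrt δ * noiseInvSqrt δ * noiseCov δ = 1 :=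
  mul_eq_one_comm.1 (noiseCov_mul_inv_sq hδ)

theorem inv_noiseCov (hδ : ∀ i, 0 < δ i) :
    (noiseCov δ)⁻¹ = noiseInvSqrt δ * noiseInvSqrt δ :=
  inv_eq_right_inv (noiseCov_mul_inv_sq hδ)

theorem posDef_noiseCov (hδ : ∀ i, 0 < δ i) : (noiseCov δ).PosDef :=
  PosDef.diagonal hδ

theorem vecMul_noiseInvSqrt_injective (hδ : ∀ i, 0 < δ i) :
    Function.Injective (noiseInvSqrt δ).vecMul := by
  rw [vecMul_injective_iff_isUnit]
  exact IsUnit.of_mul_eq_one (noiseInvSqrt δ * noiseCov δ)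
    (by rw [← Matrix.mul_assoc, inv_sq_mul_noiseCov hδ])

end Noise

/-! ### The projector P and the matrix Q = D^{-1/2} P D^{-1/2} -/

section Projection

variable {d N : ℕ} {Φ : Matrix (Fin d) (Fin N) ℝ} {δ : Fin N → ℝ}

theorem vecMul_whitened_injective (hΦ : Φ.rank = d) (hδ : ∀ i, 0 < δ i) :
    Function.Injective (Φ * noiseInvSqrt δ).vecMul := by
  intro u v huv
  simp only [← vecMul_vecMul] at huv
  exact vecMul_injective_of_rank_eq hΦ (vecMul_noiseInvSqrt_injective hδ huv)

theorem isUnit_whitened_gram (hΦ : Φ.rank = d) (hδ : ∀ i, 0 < δ i) :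
    IsUnit ((Φ * noiseInvSqrt δ) * (Φ * noiseInvSqrt δ)ᵀ).det :=
  isUnit_det_of_posDef (posDef_mul_transpose (vecMul_whitened_injective hΦ hδ))

theorem isMoorePenrose_pinv_whitened (hΦ : Φ.rank = d) (hδ : ∀ i, 0 < δ i) :
    IsMoorePenrose (Φ * noiseInvSqrt δ) (pinv (Φ * noiseInvSqrt δ)) := by
  have h := isMoorePenrose_of_isUnit (isUnit_whitened_gram hΦ hδ)
  rwa [h.pinv_eq]

theorem pinv_whitened (hΦ : Φ.rank = d) (hδ : ∀ i, 0 < δ i) :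
    pinv (Φ * noiseInvSqrt δ) = (Φ * noiseInvSqrt δ)ᵀ *
      ((Φ * noiseInvSqrt δ) * (Φ * noiseInvSqrt δ)ᵀ)⁻¹ :=
  (isMoorePenrose_of_isUnit (isUnit_whitened_gram hΦ hδ)).pinv_eq

theorem transpose_proj (hΦ : Φ.rank = d) (hδ : ∀ i, 0 < δ i) :
    (proj Φ δ)ᵀ = proj Φ δ := by
  rw [proj, transpose_sub, transpose_one, (isMoorePenrose_pinv_whitened hΦ hδ).symm_right]

theorem whitened_mul_proj (hΦ : Φ.rank = d) (hδ : ∀ i, 0 < δ i) :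
    Φ * noiseInvSqrt δ * proj Φ δ = 0 := by
  rw [proj, Matrix.mul_sub, Matrix.mul_one, ← Matrix.mul_assoc,
    (isMoorePenrose_pinv_whitened hΦ hδ).mul_inv_mul, sub_self]

theorem proj_mul_proj (hΦ : Φ.rank = d) (hδ : ∀ i, 0 < δ i) :
    proj Φ δ * proj Φ δ = proj Φ δ := by
  conv_lhs => enter [1]; rw [proj]
  rw [Matrix.sub_mul, Matrix.one_mul, Matrix.mul_assoc, whitened_mul_proj hΦ hδ, Matrix.mul_zero,
    sub_zero]

theorem proj_mulVec_eq_self_iff (hΦ : Φ.rank = d) (hδ : ∀ i, 0 < δ i) (v : Fin N → ℝ) :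
    proj Φ δ *ᵥ v = v ↔ (Φ * noiseInvSqrt δ) *ᵥ v = 0 := by
  constructor
  · intro h
    rw [← h, mulVec_mulVec, whitened_mul_proj hΦ hδ, zero_mulVec]
  · intro h
    rw [proj, sub_mulVec, one_mulVec, ← mulVec_mulVec, h, mulVec_zero, sub_zero]

theorem trace_proj (hΦ : Φ.rank = d) (hδ : ∀ i, 0 < δ i) :
    (proj Φ δ).trace = (N : ℝ) - d := by
  rw [proj, trace_sub, trace_mul_comm, pinv_whitened hΦ hδ, ← Matrix.mul_assoc,
    mul_nonsing_inv _ (isUnit_whitened_gram hΦ hδ)]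
  simp

/-- The matrix `D^{-1/2} P D^{-1/2}`. -/
def precisionProj (Φ : Matrix (Fin d) (Fin N) ℝ) (δ : Fin N → ℝ) : Matrix (Fin N) (Fin N) ℝ :=
  noiseInvSqrt δ * proj Φ δ * noiseInvSqrt δ

theorem transpose_precisionProj (hΦ : Φ.rank = d) (hδ : ∀ i, 0 < δ i) :
    (precisionProj Φ δ)ᵀ = precisionProj Φ δ := by
  simp only [precisionProj, transpose_mul, transpose_noiseInvSqrt, transpose_proj hΦ hδ,
    Matrix.mul_assoc]

theorem mul_precisionProj (hΦ : Φ.rank = d) (hδ : ∀ i, 0 < δ i) :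
    Φ * precisionProj Φ δ = 0 := by
  rw [precisionProj, ← Matrix.mul_assoc, ← Matrix.mul_assoc, whitened_mul_proj hΦ hδ,
    Matrix.zero_mul]

theorem precisionProj_mul_transpose (hΦ : Φ.rank = d) (hδ : ∀ i, 0 < δ i) :
    precisionProj Φ δ * Φᵀ = 0 := by
  have := congrArg transpose (mul_precisionProj hΦ hδ)
  rwa [transpose_mul, transpose_precisionProj hΦ hδ, transpose_zero] at this

theorem precisionProj_mul_noiseCov_mul (hΦ : Φ.rank = d) (hδ : ∀ i, 0 < δ i) :
    precisionProj Φ δ * noiseCov δ * precisionProj Φ δ = precisionProj Φ δ := by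
  have h : precisionProj Φ δ * noiseCov δ * precisionProj Φ δ
      = noiseInvSqrt δ * (proj Φ δ * (noiseInvSqrt δ * noiseCov δ * noiseInvSqrt δ) * proj Φ δ)
        * noiseInvSqrt δ := by
    simp only [precisionProj, Matrix.mul_assoc]
  rw [h, noiseInvSqrt_mul_noiseCov_mul hδ, Matrix.mul_one, proj_mul_proj hΦ hδ, precisionProj]

theorem posSemidef_precisionProj (hΦ : Φ.rank = d) (hδ : ∀ i, 0 < δ i) :
    (precisionProj Φ δ).PosSemidef := by
  have h := posSemidef_mul_mul_transpose (posDef_noiseCov hδ).posSemidef (precisionProj Φ δ)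
  rwa [transpose_precisionProj hΦ hδ, precisionProj_mul_noiseCov_mul hΦ hδ] at h

/-- The source of all independence from K: the term ΦᵀKΦ is killed by QΦᵀ = 0. -/
theorem precisionProj_mul_Om (hΦ : Φ.rank = d) (hδ : ∀ i, 0 < δ i)
    (K : Matrix (Fin d) (Fin d) ℝ) :
    precisionProj Φ δ * Om Φ δ K = precisionProj Φ δ * noiseCov δ := by
  rw [Om, Matrix.mul_add, ← Matrix.mul_assoc, ← Matrix.mul_assoc,
    precisionProj_mul_transpose hΦ hδ, Matrix.zero_mul, Matrix.zero_mul, add_zero]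

theorem trace_precisionProj_mul_Om (hΦ : Φ.rank = d) (hδ : ∀ i, 0 < δ i)
    (K : Matrix (Fin d) (Fin d) ℝ) :
    (precisionProj Φ δ * Om Φ δ K).trace = (N : ℝ) - d := by
  rw [precisionProj_mul_Om hΦ hδ, precisionProj, Matrix.mul_assoc, Matrix.mul_assoc,
    trace_mul_comm, Matrix.mul_assoc, noiseInvSqrt_mul_noiseCov_mul hδ, Matrix.mul_one,
    trace_proj hΦ hδ]

theorem Psihat_eq {p : ℕ} (Φ : Matrix (Fin d) (Fin N) ℝ) (δ : Fin N → ℝ) (ν : ℝ)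
    (Y : Matrix (Fin p) (Fin N) ℝ) :
    Psihat Φ δ ν Y = (nuP p ν / N) • (Y * precisionProj Φ δ * Yᵀ) := by
  simp only [Psihat, precisionProj, Matrix.mul_assoc]

end Projection

/-! ### Residual and H at the weighted least squares solution -/

section Omega

variable {p d N : ℕ} {Φ : Matrix (Fin d) (Fin N) ℝ} {δ : Fin N → ℝ}

theorem posSemidef_transpose_mul_mul {K : Matrix (Fin d) (Fin d) ℝ} (hK : K.PosSemidef)
    (Φ : Matrix (Fin d) (Fin N) ℝ) : (Φᵀ * K * Φ).PosSemidef := by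
  simpa using posSemidef_mul_mul_transpose hK Φᵀ

theorem posDef_Om (hδ : ∀ i, 0 < δ i) {K : Matrix (Fin d) (Fin d) ℝ} (hK : K.PosSemidef) :
    (Om Φ δ K).PosDef :=
  (posDef_noiseCov hδ).add_posSemidef (posSemidef_transpose_mul_mul hK Φ)

theorem transpose_mul_mul_eq_zero_iff (hΦ : Φ.rank = d) {K : Matrix (Fin d) (Fin d) ℝ} :
    Φᵀ * K * Φ = 0 ↔ K = 0 := by
  refine ⟨fun h => ?_, fun h => by simp [h]⟩
  have hu := isUnit_det_of_posDef (posDef_mul_transpose (vecMul_injective_of_rank_eq hΦ))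
  calc K = (Φ * Φᵀ)⁻¹ * (Φ * Φᵀ) * K * ((Φ * Φᵀ) * (Φ * Φᵀ)⁻¹) := by
        rw [nonsing_inv_mul _ hu, mul_nonsing_inv _ hu, Matrix.one_mul, Matrix.mul_one]
    _ = (Φ * Φᵀ)⁻¹ * Φ * (Φᵀ * K * Φ) * Φᵀ * (Φ * Φᵀ)⁻¹ := by simp only [Matrix.mul_assoc]
    _ = 0 := by rw [h]; simp

theorem resid_Mhat (hΦ : Φ.rank = d) (hδ : ∀ i, 0 < δ i) (Y : Matrix (Fin p) (Fin N) ℝ) :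
    resid Φ Y (Mhat Φ δ Y) = Y * precisionProj Φ δ * noiseCov δ := by
  have h1 : Φ * (noiseCov δ)⁻¹ * Φᵀ = (Φ * noiseInvSqrt δ) * (Φ * noiseInvSqrt δ)ᵀ := by
    rw [inv_noiseCov hδ, transpose_mul, transpose_noiseInvSqrt]
    simp only [Matrix.mul_assoc]
  -- Here Q = D⁻¹ - D⁻¹Φᵀ(ΦD⁻¹Φᵀ)⁻¹ΦD⁻¹, with D⁻¹ written as the square of D^{-1/2}; multiplying by
  -- Y and D gives Y - M̂Φ.
  have h2 : precisionProj Φ δ = noiseInvSqrt δ * noiseInvSqrt δ - noiseInvSqrt δ *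
      noiseInvSqrt δ * Φᵀ * (Φ * (noiseCov δ)⁻¹ * Φᵀ)⁻¹ * Φ * (noiseInvSqrt δ *
      noiseInvSqrt δ) := by
    rw [precisionProj, proj, pinv_whitened hΦ hδ, h1, transpose_mul, transpose_noiseInvSqrt,
      Matrix.mul_sub, Matrix.sub_mul, Matrix.mul_one]
    simp only [Matrix.mul_assoc]
  rw [h2, Matrix.mul_sub, Matrix.sub_mul, Matrix.mul_assoc Y, inv_sq_mul_noiseCov hδ,
    Matrix.mul_one, resid, Mhat]
  congr 1
  rw [Matrix.mul_assoc Y _ (noiseCov δ), Matrix.mul_assoc _ (noiseInvSqrt δ * noiseInvSqrt δ) (noiseCov δ), inv_sq_mul_noiseCov hδ,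
    Matrix.mul_one, inv_noiseCov hδ]
  simp only [Matrix.mul_assoc]

/-- Since YQD = YQΩ, the factor Ω cancels and K disappears. -/
theorem resid_Mhat_mul_inv_Om (hΦ : Φ.rank = d) (hδ : ∀ i, 0 < δ i)
    (Y : Matrix (Fin p) (Fin N) ℝ) {K : Matrix (Fin d) (Fin d) ℝ} (hK : K.PosSemidef) :
    resid Φ Y (Mhat Φ δ Y) * (Om Φ δ K)⁻¹ = Y * precisionProj Φ δ := by
  rw [resid_Mhat hΦ hδ, Matrix.mul_assoc Y, ← precisionProj_mul_Om hΦ hδ K, ← Matrix.mul_assoc,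
    Matrix.mul_assoc, mul_nonsing_inv _ (isUnit_det_of_posDef (posDef_Om hδ hK)), Matrix.mul_one]

theorem Hmat_Mhat (hΦ : Φ.rank = d) (hδ : ∀ i, 0 < δ i) (Y : Matrix (Fin p) (Fin N) ℝ)
    {K : Matrix (Fin d) (Fin d) ℝ} (hK : K.PosSemidef) (Ψ : Matrix (Fin p) (Fin p) ℝ) :
    Hmat Φ δ Y (Mhat Φ δ Y) K Ψ = Ψ + Y * precisionProj Φ δ * Yᵀ := by
  rw [Hmat, resid_Mhat_mul_inv_Om hΦ hδ Y hK, resid_Mhat hΦ hδ, transpose_mul, transpose_mul,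
    transpose_precisionProj hΦ hδ, transpose_eq_of_posSemidef (posDef_noiseCov hδ).posSemidef]
  congr 1
  conv_rhs => rw [← precisionProj_mul_noiseCov_mul hΦ hδ]
  simp only [Matrix.mul_assoc]

/-- A Pythagorean identity: the cross term is YQΦᵀ(M̂ - M)ᵀ = 0. -/
theorem Hmat_eq (hΦ : Φ.rank = d) (hδ : ∀ i, 0 < δ i) (Y : Matrix (Fin p) (Fin N) ℝ)
    (M : Matrix (Fin p) (Fin d) ℝ) {K : Matrix (Fin d) (Fin d) ℝ} (hK : K.PosSemidef)
    (Ψ : Matrix (Fin p) (Fin p) ℝ) :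
    Hmat Φ δ Y M K Ψ = Hmat Φ δ Y (Mhat Φ δ Y) K Ψ +
      ((Mhat Φ δ Y - M) * Φ) * (Om Φ δ K)⁻¹ * ((Mhat Φ δ Y - M) * Φ)ᵀ := by
  have hE : resid Φ Y M = resid Φ Y (Mhat Φ δ Y) + (Mhat Φ δ Y - M) * Φ := by
    rw [resid, resid, Matrix.sub_mul]; abel
  set E := resid Φ Y (Mhat Φ δ Y) with hEdef
  set F := (Mhat Φ δ Y - M) * Φ with hF
  set V := (Om Φ δ K)⁻¹ with hV
  have hsymm : Vᵀ = V := transpose_eq_of_posSemidef (posDef_Om hδ hK).inv.posSemidef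
  have h1 : E * V * Fᵀ = 0 := by
    rw [hEdef, hV, resid_Mhat_mul_inv_Om hΦ hδ Y hK, hF, transpose_mul, Matrix.mul_assoc,
      ← Matrix.mul_assoc _ Φᵀ, precisionProj_mul_transpose hΦ hδ, Matrix.zero_mul,
      Matrix.mul_zero]
  have h2 : F * V * Eᵀ = 0 := by
    have := congrArg transpose h1
    rwa [transpose_mul (E * V) Fᵀ, transpose_mul E V, transpose_transpose, hsymm, transpose_zero,
      ← Matrix.mul_assoc] at this
  rw [Hmat, Hmat, hE, transpose_add, Matrix.add_mul, Matrix.add_mul, Matrix.mul_add,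
    Matrix.mul_add, h1, h2, add_zero, zero_add, add_assoc]

end Omega

/-! ### Minimization of the loss -/

section Loss

variable {p d N : ℕ} {Φ : Matrix (Fin d) (Fin N) ℝ} {δ : Fin N → ℝ} {ν : ℝ}

theorem nuP_pos (hp : 0 < p) (hν : 2 * (p : ℝ) < ν) : 0 < nuP p ν := by
  have : (1 : ℝ) ≤ p := by exact_mod_cast hp
  rw [nuP]; linarith

theorem posDef_Hmat_Mhat (hΦ : Φ.rank = d) (hδ : ∀ i, 0 < δ i) (Y : Matrix (Fin p) (Fin N) ℝ)
    {K : Matrix (Fin d) (Fin d) ℝ} (hK : K.PosSemidef) {Ψ : Matrix (Fin p) (Fin p) ℝ}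
    (hΨ : Ψ.PosDef) : (Hmat Φ δ Y (Mhat Φ δ Y) K Ψ).PosDef := by
  rw [Hmat_Mhat hΦ hδ Y hK]
  exact hΨ.add_posSemidef (posSemidef_mul_mul_transpose (posSemidef_precisionProj hΦ hδ) Y)

/-- M enters only through ln|H|, and H grows by FΩ⁻¹Fᵀ with F = (M̂ - M)Φ, nonzero because Φ has
full row rank. -/
theorem loss_Mhat_lt (hp : 0 < p) (hν : 2 * (p : ℝ) < ν) (hΦ : Φ.rank = d)
    (hδ : ∀ i, 0 < δ i) (Y : Matrix (Fin p) (Fin N) ℝ) {K : Matrix (Fin d) (Fin d) ℝ}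
    {Ψ : Matrix (Fin p) (Fin p) ℝ} (hK : K.PosSemidef) (hΨ : Ψ.PosDef)
    {M : Matrix (Fin p) (Fin d) ℝ} (hM : M ≠ Mhat Φ δ Y) :
    loss Φ δ ν Y (Mhat Φ δ Y) K Ψ < loss Φ δ ν Y M K Ψ := by
  have hΩi := (posDef_Om (Φ := Φ) hδ hK).inv
  have hne : ((Mhat Φ δ Y - M) * Φ) * (Om Φ δ K)⁻¹ * ((Mhat Φ δ Y - M) * Φ)ᵀ ≠ 0 := by
    intro h
    have h0 := eq_zero_of_mul_mul_transpose_eq_zero hΩi h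
    apply hM
    rw [← sub_eq_zero, ← neg_eq_zero, neg_sub]
    funext i
    refine vecMul_injective_of_rank_eq hΦ ((congrFun h0 i).trans ?_)
    exact (zero_vecMul Φ).symm
  have h := log_det_lt_log_det_add (posDef_Hmat_Mhat hΦ hδ Y hK hΨ)
    (posSemidef_mul_mul_transpose hΩi.posSemidef ((Mhat Φ δ Y - M) * Φ)) hne
  rw [← Hmat_eq hΦ hδ Y M hK Ψ] at h
  have hpos : 0 < (nuP p ν + N) / 2 := by
    have := nuP_pos hp hν
    positivity
  have := mul_lt_mul_of_pos_left h hpos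
  rw [loss, loss]
  linarith

theorem loss_Mhat_le (hp : 0 < p) (hν : 2 * (p : ℝ) < ν) (hΦ : Φ.rank = d)
    (hδ : ∀ i, 0 < δ i) (Y : Matrix (Fin p) (Fin N) ℝ) {K : Matrix (Fin d) (Fin d) ℝ}
    {Ψ : Matrix (Fin p) (Fin p) ℝ} (hK : K.PosSemidef) (hΨ : Ψ.PosDef)
    (M : Matrix (Fin p) (Fin d) ℝ) :
    loss Φ δ ν Y (Mhat Φ δ Y) K Ψ ≤ loss Φ δ ν Y M K Ψ := by
  by_cases h : M = Mhat Φ δ Y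
  · rw [h]
  · exact (loss_Mhat_lt hp hν hΦ hδ Y hK hΨ h).le

/-- Twice the Ψ-dependent part of the loss is the profile of `log_det_profile_lt` with α = ν', β = N
and S = YQYᵀ. -/
theorem loss_Psihat_lt (hp : 0 < p) (hN : 0 < N) (hν : 2 * (p : ℝ) < ν) (hΦ : Φ.rank = d)
    (hδ : ∀ i, 0 < δ i) {Y : Matrix (Fin p) (Fin N) ℝ} (hY : (Psihat Φ δ ν Y).PosDef)
    {K : Matrix (Fin d) (Fin d) ℝ} {Ψ : Matrix (Fin p) (Fin p) ℝ} (hK : K.PosSemidef)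
    (hΨ : Ψ.PosDef) (hne : Ψ ≠ Psihat Φ δ ν Y) :
    loss Φ δ ν Y (Mhat Φ δ Y) K (Psihat Φ δ ν Y) < loss Φ δ ν Y (Mhat Φ δ Y) K Ψ := by
  have hν' := nuP_pos hp hν
  have hN' : (0 : ℝ) < N := by exact_mod_cast hN
  rw [Psihat_eq] at hY hne ⊢
  have hS : (Y * precisionProj Φ δ * Yᵀ).PosDef := by
    have hc : 0 < (nuP p ν / (N : ℝ))⁻¹ := by positivity
    have := hY.smul hc
    rwa [smul_smul, inv_mul_cancel₀ (by positivity), one_smul] at this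
  have := log_det_profile_lt hν' hN' hS hΨ hne
  rw [loss, loss, Hmat_Mhat hΦ hδ Y hK, Hmat_Mhat hΦ hδ Y hK]
  linarith

theorem loss_joint_lt (hp : 0 < p) (hN : 0 < N) (hν : 2 * (p : ℝ) < ν) (hΦ : Φ.rank = d)
    (hδ : ∀ i, 0 < δ i) {Y : Matrix (Fin p) (Fin N) ℝ} (hY : (Psihat Φ δ ν Y).PosDef)
    {K : Matrix (Fin d) (Fin d) ℝ} {M : Matrix (Fin p) (Fin d) ℝ}
    {Ψ : Matrix (Fin p) (Fin p) ℝ} (hK : K.PosSemidef)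
    (hΨ : Ψ.PosDef) (hne : (M, Ψ) ≠ (Mhat Φ δ Y, Psihat Φ δ ν Y)) :
    loss Φ δ ν Y (Mhat Φ δ Y) K (Psihat Φ δ ν Y) < loss Φ δ ν Y M K Ψ := by
  by_cases h : Ψ = Psihat Φ δ ν Y
  · subst h
    exact loss_Mhat_lt hp hν hΦ hδ Y hK hΨ fun hM => hne (by rw [hM])
  · exact (loss_Psihat_lt hp hN hν hΦ hδ hY hK hΨ h).trans_le (loss_Mhat_le hp hν hΦ hδ Y hK hΨ M)

theorem loss_joint_le (hp : 0 < p) (hN : 0 < N) (hν : 2 * (p : ℝ) < ν) (hΦ : Φ.rank = d)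
    (hδ : ∀ i, 0 < δ i) {Y : Matrix (Fin p) (Fin N) ℝ} (hY : (Psihat Φ δ ν Y).PosDef)
    {K : Matrix (Fin d) (Fin d) ℝ} (M : Matrix (Fin p) (Fin d) ℝ)
    {Ψ : Matrix (Fin p) (Fin p) ℝ} (hK : K.PosSemidef) (hΨ : Ψ.PosDef) :
    loss Φ δ ν Y (Mhat Φ δ Y) K (Psihat Φ δ ν Y) ≤ loss Φ δ ν Y M K Ψ := by
  by_cases h : (M, Ψ) = (Mhat Φ δ Y, Psihat Φ δ ν Y)
  · rw [Prod.mk.injEq] at h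
    rw [h.1, h.2]
  · exact (loss_joint_lt hp hN hν hΦ hδ hY hK hΨ h).le

theorem Om_add (Φ : Matrix (Fin d) (Fin N) ℝ) (δ : Fin N → ℝ) (K L : Matrix (Fin d) (Fin d) ℝ) :
    Om Φ δ (K + L) = Om Φ δ K + Φᵀ * L * Φ := by
  rw [Om, Om, Matrix.mul_add, Matrix.add_mul, add_assoc]

/-- Along `M = M̂` the loss depends on `K` only through `ln |Ω|`. -/
theorem loss_Mhat_eq (hΦ : Φ.rank = d) (hδ : ∀ i, 0 < δ i) (ν : ℝ)
    (Y : Matrix (Fin p) (Fin N) ℝ) {K : Matrix (Fin d) (Fin d) ℝ} (hK : K.PosSemidef)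
    (Ψ : Matrix (Fin p) (Fin p) ℝ) :
    loss Φ δ ν Y (Mhat Φ δ Y) K Ψ = (p : ℝ) / 2 * Real.log (Om Φ δ K).det +
      (-Real.log (normConst p N ν) - nuP p ν / 2 * Real.log Ψ.det +
      (nuP p ν + N) / 2 * Real.log (Ψ + Y * precisionProj Φ δ * Yᵀ).det) := by
  rw [loss, Hmat_Mhat hΦ hδ Y hK]
  ring

theorem loss_Mhat_lt_of_lt (hp : 0 < p) (hΦ : Φ.rank = d) (hδ : ∀ i, 0 < δ i) (ν : ℝ)
    (Y : Matrix (Fin p) (Fin N) ℝ) (Ψ : Matrix (Fin p) (Fin p) ℝ)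
    {K K' : Matrix (Fin d) (Fin d) ℝ} (hK' : K'.PosSemidef) (h : (K - K').PosSemidef)
    (hne : K ≠ K') :
    loss Φ δ ν Y (Mhat Φ δ Y) K' Ψ < loss Φ δ ν Y (Mhat Φ δ Y) K Ψ := by
  have hK : K = K' + (K - K') := by abel
  have hKp : K.PosSemidef := by rw [hK]; exact hK'.add h
  rw [loss_Mhat_eq hΦ hδ ν Y hK', loss_Mhat_eq hΦ hδ ν Y hKp]
  gcongr ?_ + _
  have hp' : (0 : ℝ) < p := by exact_mod_cast hp
  refine mul_lt_mul_of_pos_left ?_ (by positivity)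
  rw [hK, Om_add]
  exact log_det_lt_log_det_add (posDef_Om hδ hK') (posSemidef_transpose_mul_mul h Φ)
    fun h0 => hne (sub_eq_zero.1 ((transpose_mul_mul_eq_zero_iff hΦ).1 h0))

theorem concaveOn_loss_Mhat (hΦ : Φ.rank = d) (hδ : ∀ i, 0 < δ i) (ν : ℝ)
    (Y : Matrix (Fin p) (Fin N) ℝ) (Ψ : Matrix (Fin p) (Fin p) ℝ) :
    ConcaveOn ℝ {K : Matrix (Fin d) (Fin d) ℝ | K.PosSemidef}
      (fun K => loss Φ δ ν Y (Mhat Φ δ Y) K Ψ) := by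
  refine ⟨fun K hK L hL s t hs ht _ => (PosSemidef.smul hK hs).add (PosSemidef.smul hL ht), ?_⟩
  intro K hK L hL s t hs ht hst
  have hKL : (s • K + t • L).PosSemidef := (PosSemidef.smul hK hs).add (PosSemidef.smul hL ht)
  have hO : Om Φ δ (s • K + t • L) = s • Om Φ δ K + t • Om Φ δ L := by
    simp only [Om, Matrix.mul_add, Matrix.add_mul, Matrix.mul_smul, Matrix.smul_mul, smul_add]
    have : noiseCov δ = s • noiseCov δ + t • noiseCov δ := by rw [← add_smul, hst, one_smul]
    nth_rewrite 1 [this]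
    abel
  have key := log_det_concave (posDef_Om (Φ := Φ) hδ hK) (posDef_Om (Φ := Φ) hδ hL) hs ht hst
  simp only [smul_eq_mul]
  rw [loss_Mhat_eq hΦ hδ ν Y hK, loss_Mhat_eq hΦ hδ ν Y hL, loss_Mhat_eq hΦ hδ ν Y hKL, hO]
  have hp' : (0 : ℝ) ≤ p / 2 := by positivity
  have := mul_le_mul_of_nonneg_left key hp'
  have ht' : t = 1 - s := by linarith
  subst ht'
  linarith

/-- For d > 0 the bound is not attained by a positive definite K; it is approached along K = εI as ε
decreases to 0. -/
theorem isGLB_loss_Mhat (hp : 0 < p) (hΦ : Φ.rank = d) (hδ : ∀ i, 0 < δ i) (ν : ℝ)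
    (Y : Matrix (Fin p) (Fin N) ℝ) (Ψ : Matrix (Fin p) (Fin p) ℝ) :
    IsGLB {r : ℝ | ∃ K : Matrix (Fin d) (Fin d) ℝ, K.PosDef ∧
      r = loss Φ δ ν Y (Mhat Φ δ Y) K Ψ} (loss Φ δ ν Y (Mhat Φ δ Y) 0 Ψ) := by
  constructor
  · rintro r ⟨K, hK, rfl⟩
    -- A positive definite K can be zero only when d = 0.
    by_cases h : K = 0
    · rw [h]
    · exact (loss_Mhat_lt_of_lt hp hΦ hδ ν Y Ψ PosSemidef.zero (by simpa using hK.posSemidef)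
        h).le
  · intro b hb
    have hcont : Filter.Tendsto (fun ε : ℝ => (p : ℝ) / 2 *
        Real.log (Om Φ δ (ε • (1 : Matrix (Fin d) (Fin d) ℝ))).det +
      (-Real.log (normConst p N ν) - nuP p ν / 2 * Real.log Ψ.det +
      (nuP p ν + N) / 2 * Real.log (Ψ + Y * precisionProj Φ δ * Yᵀ).det))
        (nhdsWithin 0 (Set.Ioi 0)) (nhds (loss Φ δ ν Y (Mhat Φ δ Y) 0 Ψ)) := by
      rw [loss_Mhat_eq hΦ hδ ν Y PosSemidef.zero]
      apply tendsto_nhdsWithin_of_tendsto_nhds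
      refine Filter.Tendsto.add_const _ (Filter.Tendsto.const_mul _ ?_)
      have hc : Continuous fun ε : ℝ => (Om Φ δ (ε • (1 : Matrix (Fin d) (Fin d) ℝ))).det := by
        unfold Om; fun_prop
      have h0 := hc.tendsto 0
      rw [zero_smul] at h0
      exact h0.log (posDef_Om hδ PosSemidef.zero).det_pos.ne'
    refine ge_of_tendsto hcont ?_
    filter_upwards [self_mem_nhdsWithin] with ε hε
    have hK : (ε • (1 : Matrix (Fin d) (Fin d) ℝ)).PosDef := PosDef.one.smul hε
    exact hb ⟨_, hK, (loss_Mhat_eq hΦ hδ ν Y hK.posSemidef Ψ).symm⟩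

end Loss

/-! ### Gamma, Gaussian and Student integrals -/

section RadialIntegral

theorem lintegral_rpow_mul_exp_neg {a r : ℝ} (ha : 0 < a) (hr : 0 < r) :
    ∫⁻ t in Set.Ioi (0 : ℝ), ENNReal.ofReal (t ^ (a - 1) * Real.exp (-(r * t))) =
      ENNReal.ofReal ((1 / r) ^ a * Real.Gamma a) := by
  have hI := Real.integral_rpow_mul_exp_neg_mul_Ioi ha hr
  have hpos : 0 < (1 / r) ^ a * Real.Gamma a := by
    have := Real.Gamma_pos_of_pos ha
    positivity
  rw [← hI, ofReal_integral_eq_lintegral_ofReal]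
  -- The Bochner integral of a non-integrable function is 0 by convention, so a positive value
  -- proves integrability.
  · exact not_imp_comm.1 integral_undef (by rw [hI]; exact hpos.ne')
  · filter_upwards [self_mem_ae_restrict measurableSet_Ioi] with t ht
    have : (0 : ℝ) < t := ht
    positivity

theorem lintegral_exp_neg_mul_dotProduct (n : ℕ) {t : ℝ} (ht : 0 < t) :
    ∫⁻ z : Fin n → ℝ, ENNReal.ofReal (Real.exp (-(t * (z ⬝ᵥ z)))) =
      ENNReal.ofReal ((Real.pi / t) ^ ((n : ℝ) / 2)) := by
  have hI : ∫ z : Fin n → ℝ, Real.exp (-(t * (z ⬝ᵥ z))) = (Real.pi / t) ^ ((n : ℝ) / 2) := by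
    have h := integral_fintype_prod_volume_eq_pow (ι := Fin n)
      (fun x : ℝ => Real.exp (-t * x ^ 2))
    rw [integral_gaussian, Fintype.card_fin] at h
    rw [Real.rpow_div_two_eq_sqrt _ (by positivity), Real.rpow_natCast, ← h]
    congr 1
    funext z
    rw [← Real.exp_sum, dotProduct, Finset.mul_sum, ← Finset.sum_neg_distrib]
    congr 1
    exact Finset.sum_congr rfl fun i _ => by ring
  have hpos : 0 < (Real.pi / t) ^ ((n : ℝ) / 2) := by positivity
  rw [← hI, ofReal_integral_eq_lintegral_ofReal]
  · exact not_imp_comm.1 integral_undef (by rw [hI]; exact hpos.ne')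
  · exact Filter.Eventually.of_forall fun _ => (Real.exp_pos _).le

/-- The integral of `(1 + ‖z‖²)^{-a}` over `ℝⁿ`. -/
def studentConst (n : ℕ) (a : ℝ) : ℝ :=
  Real.pi ^ ((n : ℝ) / 2) * Real.Gamma (a - n / 2) / Real.Gamma a

theorem studentConst_pos {n : ℕ} {a : ℝ} (ha : (n : ℝ) / 2 < a) : 0 < studentConst n a := by
  have h0 : (0 : ℝ) ≤ n / 2 := by positivity
  have h1 := Real.Gamma_pos_of_pos (sub_pos.2 ha)
  have h2 := Real.Gamma_pos_of_pos (h0.trans_lt ha)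
  unfold studentConst
  positivity

theorem dotProduct_self_nonneg' {n : ℕ} (z : Fin n → ℝ) : 0 ≤ z ⬝ᵥ z :=
  Finset.sum_nonneg fun i _ => mul_self_nonneg (z i)

/-- Write Γ(a)(1 + |z|²)^{-a} as the integral over t > 0 of t^{a-1} exp(-(1 + |z|²)t) and exchange
integrals: the Gaussian in z contributes (π/t)^{n/2}, leaving a Gamma integral with parameter a -
n/2. -/
theorem lintegral_one_add_dotProduct_rpow {n : ℕ} {a : ℝ} (ha : (n : ℝ) / 2 < a) :
    ∫⁻ z : Fin n → ℝ, ENNReal.ofReal ((1 + z ⬝ᵥ z) ^ (-a)) =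
      ENNReal.ofReal (studentConst n a) := by
  have hn0 : (0 : ℝ) ≤ n / 2 := by positivity
  have ha0 : 0 < a := hn0.trans_lt ha
  have hΓ := Real.Gamma_pos_of_pos ha0
  have hmeas : Measurable fun q : (Fin n → ℝ) × ℝ =>
      ENNReal.ofReal (q.2 ^ (a - 1) * Real.exp (-((1 + q.1 ⬝ᵥ q.1) * q.2))) := by
    unfold dotProduct
    fun_prop
  have h1 : ∀ z : Fin n → ℝ, ENNReal.ofReal ((1 + z ⬝ᵥ z) ^ (-a)) * ENNReal.ofReal (Real.Gamma a)
      = ∫⁻ t in Set.Ioi (0 : ℝ),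
        ENNReal.ofReal (t ^ (a - 1) * Real.exp (-((1 + z ⬝ᵥ z) * t))) := by
    intro z
    have hz : 0 < 1 + z ⬝ᵥ z := by linarith [dotProduct_self_nonneg' z]
    rw [lintegral_rpow_mul_exp_neg ha0 hz, one_div, Real.inv_rpow hz.le, ← Real.rpow_neg hz.le,
      ENNReal.ofReal_mul (by positivity)]
  have h2 : ∀ t ∈ Set.Ioi (0 : ℝ), ∫⁻ z : Fin n → ℝ,
      ENNReal.ofReal (t ^ (a - 1) * Real.exp (-((1 + z ⬝ᵥ z) * t))) =
      ENNReal.ofReal (Real.pi ^ ((n : ℝ) / 2)) *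
        ENNReal.ofReal (t ^ (a - n / 2 - 1) * Real.exp (-(1 * t))) := by
    intro t ht
    have ht0 : (0 : ℝ) < t := ht
    have : ∀ z : Fin n → ℝ, ENNReal.ofReal (t ^ (a - 1) * Real.exp (-((1 + z ⬝ᵥ z) * t))) =
        ENNReal.ofReal (t ^ (a - 1) * Real.exp (-t)) *
          ENNReal.ofReal (Real.exp (-(t * (z ⬝ᵥ z)))) := by
      intro z
      rw [← ENNReal.ofReal_mul (by positivity), mul_assoc, ← Real.exp_add]
      ring_nf
    simp only [this]
    rw [lintegral_const_mul' _ _ ENNReal.ofReal_ne_top, lintegral_exp_neg_mul_dotProduct n ht0,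
      ← ENNReal.ofReal_mul (by positivity), ← ENNReal.ofReal_mul (by positivity)]
    congr 1
    rw [Real.div_rpow Real.pi_pos.le ht0.le, show a - n / 2 - 1 = (a - 1) - n / 2 by ring,
      Real.rpow_sub ht0 (a - 1), one_mul]
    ring
  have h3 : (∫⁻ z : Fin n → ℝ, ENNReal.ofReal ((1 + z ⬝ᵥ z) ^ (-a))) *
      ENNReal.ofReal (Real.Gamma a) =
      ENNReal.ofReal (Real.pi ^ ((n : ℝ) / 2) * Real.Gamma (a - n / 2)) := by
    rw [← lintegral_mul_const' _ _ ENNReal.ofReal_ne_top]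
    simp only [h1]
    rw [lintegral_lintegral_swap hmeas.aemeasurable, setLIntegral_congr_fun measurableSet_Ioi h2,
      lintegral_const_mul' _ _ ENNReal.ofReal_ne_top,
      lintegral_rpow_mul_exp_neg (sub_pos.2 ha) one_pos, div_one, Real.one_rpow, one_mul,
      ENNReal.ofReal_mul (by positivity)]
  rw [studentConst, ENNReal.ofReal_div_of_pos hΓ, ← h3, ENNReal.mul_div_cancel_right
    (by simpa using hΓ) ENNReal.ofReal_ne_top]

end RadialIntegral

/-! ### Linear changes of variables on arrays -/

section ChangeOfVariables

theorem lintegral_comp_linearMap {E : Type*} [NormedAddCommGroup E] [NormedSpace ℝ E]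
    [MeasurableSpace E] [BorelSpace E] [FiniteDimensional ℝ E] (μ : Measure E)
    [μ.IsAddHaarMeasure] {L : E →ₗ[ℝ] E} (hL : LinearMap.det L ≠ 0) {f : E → ENNReal}
    (hf : Measurable f) :
    ∫⁻ x, f x ∂μ = ENNReal.ofReal |LinearMap.det L| * ∫⁻ x, f (L x) ∂μ := by
  have hLm : Measurable L := (LinearMap.continuous_of_finiteDimensional L).measurable
  rw [← lintegral_map hf hLm, Measure.map_linearMap_addHaar_eq_smul_addHaar μ hL,
    lintegral_smul_measure, smul_eq_mul, ← mul_assoc, ← ENNReal.ofReal_mul (abs_nonneg _),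
    ← abs_mul, mul_inv_cancel₀ hL, abs_one, ENNReal.ofReal_one, one_mul]

variable {p n : ℕ}

/-- The linear map `Z ↦ A Z B` on arrays. -/
def sandwich (A : Matrix (Fin p) (Fin p) ℝ) (B : Matrix (Fin n) (Fin n) ℝ) :
    (Fin p → Fin n → ℝ) →ₗ[ℝ] (Fin p → Fin n → ℝ) where
  toFun Z := A * Matrix.of Z * B
  map_add' Y Z := by
    change A * (Matrix.of Y + Matrix.of Z) * B = _
    rw [Matrix.mul_add, Matrix.add_mul]; rfl
  map_smul' c Z := by
    change A * (c • Matrix.of Z) * B = _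
    rw [Matrix.mul_smul, Matrix.smul_mul]; rfl

/-- Each of the p rows is transformed separately by Bᵀ. -/
theorem det_sandwich_one_left (B : Matrix (Fin n) (Fin n) ℝ) :
    LinearMap.det (sandwich (1 : Matrix (Fin p) (Fin p) ℝ) B) = B.det ^ p := by
  have : sandwich (1 : Matrix (Fin p) (Fin p) ℝ) B =
      LinearMap.pi fun i => (toLin' Bᵀ).comp (LinearMap.proj i) := by
    apply LinearMap.ext
    intro Z
    funext i j
    change ((1 : Matrix (Fin p) (Fin p) ℝ) * Matrix.of Z * B : Matrix (Fin p) (Fin n) ℝ) i j =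
      (Bᵀ *ᵥ Z i) j
    rw [Matrix.one_mul, mulVec_transpose]
    rfl
  rw [this, LinearMap.det_pi]
  simp

/-- Transposition of arrays conjugates left multiplication by A into right multiplication by Aᵀ. -/
theorem det_sandwich_one_right (A : Matrix (Fin p) (Fin p) ℝ) :
    LinearMap.det (sandwich A (1 : Matrix (Fin n) (Fin n) ℝ)) = A.det ^ n := by
  let e : (Fin n → Fin p → ℝ) ≃ₗ[ℝ] (Fin p → Fin n → ℝ) :=
    { toFun := fun Z i j => Z j i
      invFun := fun Z i j => Z j i
      map_add' := fun _ _ => rfl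
      map_smul' := fun _ _ => rfl
      left_inv := fun _ => rfl
      right_inv := fun _ => rfl }
  have h : sandwich A (1 : Matrix (Fin n) (Fin n) ℝ) =
      (e : (Fin n → Fin p → ℝ) →ₗ[ℝ] (Fin p → Fin n → ℝ)) ∘ₗ
        sandwich (1 : Matrix (Fin n) (Fin n) ℝ) Aᵀ ∘ₗ
        (e.symm : (Fin p → Fin n → ℝ) →ₗ[ℝ] (Fin n → Fin p → ℝ)) := by
    apply LinearMap.ext
    intro Z
    funext i j
    change (A * Matrix.of Z * (1 : Matrix (Fin n) (Fin n) ℝ) : Matrix (Fin p) (Fin n) ℝ) i j =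
      ((1 : Matrix (Fin n) (Fin n) ℝ) * Matrix.of (fun i j => Z j i) * Aᵀ :
        Matrix (Fin n) (Fin p) ℝ) j i
    rw [Matrix.mul_one, Matrix.one_mul]
    simp [Matrix.mul_apply, mul_comm]
  rw [h, LinearMap.det_conj, det_sandwich_one_left, det_transpose]

theorem det_sandwich (A : Matrix (Fin p) (Fin p) ℝ) (B : Matrix (Fin n) (Fin n) ℝ) :
    LinearMap.det (sandwich A B) = A.det ^ n * B.det ^ p := by
  have h : sandwich A B = sandwich A 1 ∘ₗ sandwich 1 B := by
    apply LinearMap.ext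
    intro Z
    change A * Matrix.of Z * B = A * ((1 : Matrix (Fin p) (Fin p) ℝ) * Matrix.of Z * B) *
      (1 : Matrix (Fin n) (Fin n) ℝ)
    rw [Matrix.one_mul, Matrix.mul_one, Matrix.mul_assoc]
  rw [h, LinearMap.det_comp, det_sandwich_one_left, det_sandwich_one_right]

theorem measurable_sandwich (A : Matrix (Fin p) (Fin p) ℝ) (B : Matrix (Fin n) (Fin n) ℝ) :
    Measurable (sandwich A B) :=
  (LinearMap.continuous_of_finiteDimensional _).measurable

end ChangeOfVariables

/-! ### Integrals of powers of Gram determinants, row by row -/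

section GramIntegral

variable {p n : ℕ}

theorem posDef_add_vecMulVec {B : Matrix (Fin n) (Fin n) ℝ} (hB : B.PosDef) (z : Fin n → ℝ) :
    (B + vecMulVec z z).PosDef := by
  have := posSemidef_vecMulVec_self_star z
  rw [star_trivial] at this
  exact hB.add_posSemidef this

theorem det_one_add_vecMulVec_self (z : Fin n → ℝ) : (1 + vecMulVec z z).det = 1 + z ⬝ᵥ z := by
  rw [vecMulVec_eq Unit, det_one_add_replicateCol_mul_replicateRow]

theorem measurable_det_add_vecMulVec (B : Matrix (Fin n) (Fin n) ℝ) :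
    Measurable fun z : Fin n → ℝ => (B + vecMulVec z z).det := by
  have : Continuous fun z : Fin n → ℝ => (B + vecMulVec z z).det := by fun_prop
  exact this.measurable

theorem continuous_det_add_gram (B : Matrix (Fin n) (Fin n) ℝ) :
    Continuous fun Z : Fin p → Fin n → ℝ => (B + (Matrix.of Z)ᵀ * Matrix.of Z).det := by
  have h : Continuous fun Z : Fin p → Fin n → ℝ => (Matrix.of Z : Matrix (Fin p) (Fin n) ℝ) :=
    continuous_id
  fun_prop

theorem measurable_det_add_gram (B : Matrix (Fin n) (Fin n) ℝ) :
    Measurable fun Z : Fin p → Fin n → ℝ => (B + (Matrix.of Z)ᵀ * Matrix.of Z).det :=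
  (continuous_det_add_gram B).measurable

/-- Substituting z = Gw with B = GGᵀ gives |B|(1 + |w|²); the Jacobian |det G| = |B|^{1/2} accounts
for the shift of the exponent by 1/2. -/
theorem lintegral_det_add_vecMulVec_rpow {B : Matrix (Fin n) (Fin n) ℝ} (hB : B.PosDef) {a : ℝ}
    (ha : (n : ℝ) / 2 < a) :
    ∫⁻ z : Fin n → ℝ, ENNReal.ofReal ((B + vecMulVec z z).det ^ (-a)) =
      ENNReal.ofReal (B.det ^ (-(a - 1 / 2)) * studentConst n a) := by
  have hBd := hB.det_pos
  obtain ⟨G, hG, rfl⟩ := exists_eq_mul_transpose_of_posDef hB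
  have hG0 : LinearMap.det (toLin' G) ≠ 0 := by rw [LinearMap.det_toLin']; exact hG.ne_zero
  have hdet : ∀ w : Fin n → ℝ, (G * Gᵀ + vecMulVec (toLin' G w) (toLin' G w)).det =
      (G * Gᵀ).det * (1 + w ⬝ᵥ w) := by
    intro w
    have : G * Gᵀ + vecMulVec (toLin' G w) (toLin' G w) = G * (1 + vecMulVec w w) * Gᵀ := by
      rw [Matrix.mul_add, Matrix.add_mul, Matrix.mul_one, toLin'_apply, mul_vecMulVec,
        vecMulVec_mul, vecMul_transpose]
    rw [this, det_mul, det_mul, det_mul, det_one_add_vecMulVec_self]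
    ring
  rw [lintegral_comp_linearMap volume hG0
    ((measurable_det_add_vecMulVec _).pow_const _).ennreal_ofReal]
  have h1 : ∀ w : Fin n → ℝ,
      ENNReal.ofReal ((G * Gᵀ + vecMulVec (toLin' G w) (toLin' G w)).det ^ (-a)) =
      ENNReal.ofReal ((G * Gᵀ).det ^ (-a)) * ENNReal.ofReal ((1 + w ⬝ᵥ w) ^ (-a)) := by
    intro w
    have hw := dotProduct_self_nonneg' w
    rw [hdet, Real.mul_rpow hBd.le (by linarith), ENNReal.ofReal_mul (by positivity)]
  simp only [h1]
  rw [lintegral_const_mul' _ _ ENNReal.ofReal_ne_top, lintegral_one_add_dotProduct_rpow ha,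
    ← ENNReal.ofReal_mul (by positivity), ← ENNReal.ofReal_mul (abs_nonneg _), LinearMap.det_toLin']
  congr 1
  rw [show -(a - 1 / 2) = 1 / 2 + -a by ring, Real.rpow_add hBd, ← Real.sqrt_eq_rpow]
  have : √(G * Gᵀ).det = |G.det| := by rw [det_mul, det_transpose, Real.sqrt_mul_self_eq_abs]
  rw [this, mul_assoc]

theorem lintegral_insertNth (i : Fin (p + 1)) {f : (Fin (p + 1) → Fin n → ℝ) → ENNReal}
    (hf : Measurable f) :
    ∫⁻ Z, f Z = ∫⁻ z : Fin n → ℝ, ∫⁻ Z : Fin p → Fin n → ℝ, f (i.insertNth z Z) := by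
  have e := (volume_preserving_piFinSuccAbove (fun _ : Fin (p + 1) => Fin n → ℝ) i).symm
  rw [← e.lintegral_comp hf, Measure.volume_eq_prod, lintegral_prod]
  · rfl
  · exact (hf.comp e.measurable).aemeasurable

theorem gram_insertNth (i : Fin (p + 1)) (z : Fin n → ℝ) (Z : Fin p → Fin n → ℝ) :
    (Matrix.of (i.insertNth z Z : Fin (p + 1) → Fin n → ℝ))ᵀ *
      Matrix.of (i.insertNth z Z : Fin (p + 1) → Fin n → ℝ) =
      vecMulVec z z + (Matrix.of Z)ᵀ * Matrix.of Z := by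
  ext a b
  simp [Matrix.mul_apply, Fin.sum_univ_succAbove _ i, vecMulVec_apply]

/-- Induction on the number of rows, for all B at once: the row z peeled off is absorbed into B +
zzᵀ, and integrating out the other p rows leaves |B + zzᵀ|^{-(a - p/2)}, a one-row integral. -/
theorem lintegral_det_add_gram_rpow (p : ℕ) {B : Matrix (Fin n) (Fin n) ℝ} (hB : B.PosDef)
    {a : ℝ} (ha : ((n : ℝ) + p - 1) / 2 < a) :
    ∫⁻ Z : Fin p → Fin n → ℝ,
        ENNReal.ofReal ((B + (Matrix.of Z)ᵀ * Matrix.of Z).det ^ (-a)) =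
      ENNReal.ofReal (B.det ^ (-(a - p / 2)) *
        ∏ k ∈ Finset.range p, studentConst n (a - (k : ℝ) / 2)) := by
  induction p generalizing B with
  | zero =>
    rw [volume_pi, Measure.pi_of_empty _ (fun i => i.elim0), lintegral_dirac]
    have : (Matrix.of (fun i : Fin 0 => (i.elim0 : Fin n → ℝ)))ᵀ *
        Matrix.of (fun i : Fin 0 => (i.elim0 : Fin n → ℝ)) = 0 := by
      ext a b; simp [Matrix.mul_apply]
    rw [this]
    simp
  | succ p ih =>
    push_cast at ha
    rw [lintegral_insertNth 0 ((measurable_det_add_gram B).pow_const _).ennreal_ofReal]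
    have hprod : 0 ≤ ∏ k ∈ Finset.range p, studentConst n (a - (k : ℝ) / 2) := by
      refine Finset.prod_nonneg fun k hk => (studentConst_pos ?_).le
      have : (k : ℝ) ≤ p := by exact_mod_cast (Finset.mem_range.1 hk).le
      linarith
    have h1 : ∀ z : Fin n → ℝ, ∫⁻ Z : Fin p → Fin n → ℝ, ENNReal.ofReal
        ((B + (Matrix.of ((0 : Fin (p + 1)).insertNth z Z : Fin (p + 1) → Fin n → ℝ))ᵀ *
          Matrix.of ((0 : Fin (p + 1)).insertNth z Z : Fin (p + 1) → Fin n → ℝ)).det ^ (-a)) =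
        ENNReal.ofReal (∏ k ∈ Finset.range p, studentConst n (a - (k : ℝ) / 2)) *
          ENNReal.ofReal ((B + vecMulVec z z).det ^ (-(a - p / 2))) := by
      intro z
      simp only [gram_insertNth, ← add_assoc]
      rw [ih (posDef_add_vecMulVec hB z) (by linarith), mul_comm, ENNReal.ofReal_mul hprod]
    simp only [h1]
    rw [lintegral_const_mul' _ _ ENNReal.ofReal_ne_top,
      lintegral_det_add_vecMulVec_rpow hB (by linarith), ← ENNReal.ofReal_mul hprod,
      Finset.prod_range_succ]
    congr 1
    push_cast
    rw [show a - (p : ℝ) / 2 - 1 / 2 = a - ((p : ℝ) + 1) / 2 by ring]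
    ring

/-- Integrating out all rows but one. -/
theorem lintegral_row_mul_det_one_add_gram_rpow {a : ℝ} (ha : ((n : ℝ) + p - 1) / 2 < a)
    (i : Fin (p + 1)) {h : (Fin n → ℝ) → ENNReal} (hh : Measurable h) :
    ∫⁻ Z : Fin (p + 1) → Fin n → ℝ,
        h (Z i) * ENNReal.ofReal ((1 + (Matrix.of Z)ᵀ * Matrix.of Z).det ^ (-a)) =
      ENNReal.ofReal (∏ k ∈ Finset.range p, studentConst n (a - (k : ℝ) / 2)) *
        ∫⁻ z, h z * ENNReal.ofReal ((1 + z ⬝ᵥ z) ^ (-(a - p / 2))) := by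
  have hm : Measurable fun Z : Fin (p + 1) → Fin n → ℝ =>
      h (Z i) * ENNReal.ofReal ((1 + (Matrix.of Z)ᵀ * Matrix.of Z).det ^ (-a)) :=
    (hh.comp (measurable_pi_apply i)).mul
      ((measurable_det_add_gram 1).pow_const _).ennreal_ofReal
  rw [lintegral_insertNth i hm]
  have hprod : 0 ≤ ∏ k ∈ Finset.range p, studentConst n (a - (k : ℝ) / 2) := by
    refine Finset.prod_nonneg fun k hk => (studentConst_pos ?_).le
    have : (k : ℝ) + 1 ≤ p := by exact_mod_cast Finset.mem_range.1 hk
    linarith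
  rw [← lintegral_const_mul' _ _ ENNReal.ofReal_ne_top]
  congr 1
  funext z
  simp only [gram_insertNth, ← add_assoc, Fin.insertNth_apply_same]
  rw [lintegral_const_mul _ ((measurable_det_add_gram _).pow_const _).ennreal_ofReal,
    lintegral_det_add_gram_rpow p (posDef_add_vecMulVec PosDef.one z) ha,
    det_one_add_vecMulVec_self, mul_comm (_ ^ _), ENNReal.ofReal_mul hprod]
  ring

end GramIntegral

/-! ### The normalizing constant through multivariate gamma functions -/

section Normalization

theorem multiGamma_pos {p : ℕ} {a : ℝ} (ha : ((p : ℝ) - 1) / 2 < a) : 0 < multiGamma p a := by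
  unfold multiGamma
  refine mul_pos (by positivity) (Finset.prod_pos fun j _ => Real.Gamma_pos_of_pos ?_)
  have : (j : ℝ) + 1 ≤ p := by exact_mod_cast j.2
  linarith

/-- The factors Γ(a - k/2 - n/2)/Γ(a - k/2) assemble into two multivariate gammas whose powers
π^{p(p-1)/4} cancel. -/
theorem prod_studentConst (p n : ℕ) (a : ℝ) :
    ∏ k ∈ Finset.range p, studentConst n (a - (k : ℝ) / 2) =
      Real.pi ^ ((n : ℝ) * (p : ℝ) / 2) * (multiGamma p (a - n / 2) / multiGamma p a) := by
  have h0 : Real.pi ^ ((p : ℝ) * ((p : ℝ) - 1) / 4) ≠ 0 := by positivity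
  rw [multiGamma, multiGamma, mul_div_mul_left _ _ h0, ← Finset.prod_div_distrib,
    Finset.prod_range, show (n : ℝ) * p / 2 = n / 2 * p by ring, Real.rpow_mul_natCast (by positivity)]
  simp only [studentConst, mul_div_assoc, Finset.prod_mul_distrib, Finset.prod_const,
    Finset.card_univ, Fintype.card_fin]
  congr 1
  refine Finset.prod_congr rfl fun k _ => ?_
  rw [sub_right_comm]

/-- The normalizing constant of the standard matrix-T density. -/
def tConst (p n : ℕ) (κ : ℝ) : ℝ :=
  multiGamma p ((κ + n + p - 1) / 2) /
    (multiGamma p ((κ + p - 1) / 2) * Real.pi ^ ((n : ℝ) * (p : ℝ) / 2))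

theorem tConst_pos {p n : ℕ} {κ : ℝ} (hκ : 0 < κ) : 0 < tConst p n κ := by
  have h1 : 0 < multiGamma p ((κ + n + p - 1) / 2) := multiGamma_pos (by
    have : (0 : ℝ) ≤ n := by positivity
    linarith)
  have h2 : 0 < multiGamma p ((κ + p - 1) / 2) := multiGamma_pos (by linarith)
  unfold tConst
  positivity

theorem tConst_mul_prod_studentConst {p n : ℕ} {κ : ℝ} (hκ : 0 < κ) :
    tConst p n κ * ∏ k ∈ Finset.range p, studentConst n ((κ + n + p - 1) / 2 - (k : ℝ) / 2) = 1 := by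
  have h1 : 0 < multiGamma p ((κ + n + p - 1) / 2) := multiGamma_pos (by
    have : (0 : ℝ) ≤ n := by positivity
    linarith)
  have h2 : 0 < multiGamma p ((κ + p - 1) / 2) := multiGamma_pos (by linarith)
  have h3 : 0 < Real.pi ^ ((n : ℝ) * (p : ℝ) / 2) := by positivity
  rw [prod_studentConst, tConst,
    show (κ + n + p - 1) / 2 - (n : ℝ) / 2 = (κ + p - 1) / 2 by ring]
  field_simp

end Normalization

/-! ### The matrix-T law as an affine image of the standard one -/

section MatrixT

variable {p n : ℕ} {κ : ℝ}

/-- The identity |I + ZZᵀ| = |I + ZᵀZ| makes the matrix a sum over rows, as row-by-row integration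
requires. -/
theorem matrixTPDF_standard (κ : ℝ) (Z : Matrix (Fin p) (Fin n) ℝ) :
    matrixTPDF 0 1 1 κ Z = tConst p n κ * (1 + Zᵀ * Z).det ^ (-((κ + n + p - 1) / 2)) := by
  rw [matrixTPDF, tConst, det_one, det_one, Real.one_rpow, Real.one_rpow, inv_one, inv_one,
    sub_zero, Matrix.one_mul, Matrix.mul_one, mul_one, mul_one, det_one_add_mul_comm]

theorem measurable_matrixTPDF (M₀ : Matrix (Fin p) (Fin n) ℝ) (S : Matrix (Fin p) (Fin p) ℝ)
    (W : Matrix (Fin n) (Fin n) ℝ) (κ : ℝ) :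
    Measurable fun T : Fin p → Fin n → ℝ => matrixTPDF M₀ S W κ (Matrix.of T) := by
  have h : Continuous fun Z : Fin p → Fin n → ℝ => (Matrix.of Z : Matrix (Fin p) (Fin n) ℝ) :=
    continuous_id
  have h2 : Continuous fun T : Fin p → Fin n → ℝ =>
      (1 + S⁻¹ * (Matrix.of T - M₀) * W⁻¹ * (Matrix.of T - M₀)ᵀ).det := by fun_prop
  unfold matrixTPDF
  exact (h2.measurable.pow_const _).const_mul _

theorem isProbabilityMeasure_matrixT_standard (p n : ℕ) (hκ : 0 < κ) :
    IsProbabilityMeasure (matrixT (0 : Matrix (Fin p) (Fin n) ℝ) 1 1 κ) := by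
  constructor
  rw [matrixT, withDensity_apply _ MeasurableSet.univ, Measure.restrict_univ]
  simp only [matrixTPDF_standard, ENNReal.ofReal_mul (tConst_pos hκ).le]
  rw [lintegral_const_mul' _ _ ENNReal.ofReal_ne_top,
    lintegral_det_add_gram_rpow p PosDef.one (by linarith), ← ENNReal.ofReal_mul
    (tConst_pos hκ).le, det_one, Real.one_rpow, one_mul, tConst_mul_prod_studentConst hκ,
    ENNReal.ofReal_one]

/-- The Jacobian of Z ↦ AZB cancels the determinant prefactors of the density, as |AAᵀ|^{n/2} = |det
A|ⁿ and likewise for B. -/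
theorem matrixTPDF_sandwich (M₀ : Matrix (Fin p) (Fin n) ℝ) {A : Matrix (Fin p) (Fin p) ℝ}
    {B : Matrix (Fin n) (Fin n) ℝ} (hA : IsUnit A.det) (hB : IsUnit B.det) (κ : ℝ)
    (Z : Matrix (Fin p) (Fin n) ℝ) :
    |A.det ^ n * B.det ^ p| * matrixTPDF M₀ (A * Aᵀ) (Bᵀ * B) κ (M₀ + A * Z * B) =
      matrixTPDF 0 1 1 κ Z := by
  have hAt : IsUnit Aᵀ.det := by simpa using hA
  have hBt : IsUnit Bᵀ.det := by simpa using hB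
  have hA0 : 0 < |A.det| := abs_pos.2 hA.ne_zero
  have hB0 : 0 < |B.det| := abs_pos.2 hB.ne_zero
  have h1 : (A * Aᵀ).det ^ (-((n : ℝ) / 2)) = (|A.det| ^ n)⁻¹ := by
    rw [det_mul, det_transpose, ← abs_mul_abs_self, Real.mul_rpow hA0.le hA0.le,
      ← Real.rpow_add hA0, show -((n : ℝ) / 2) + -((n : ℝ) / 2) = -n by ring,
      Real.rpow_neg hA0.le, Real.rpow_natCast]
  have h2 : (Bᵀ * B).det ^ (-((p : ℝ) / 2)) = (|B.det| ^ p)⁻¹ := by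
    rw [det_mul, det_transpose, ← abs_mul_abs_self, Real.mul_rpow hB0.le hB0.le,
      ← Real.rpow_add hB0, show -((p : ℝ) / 2) + -((p : ℝ) / 2) = -p by ring,
      Real.rpow_neg hB0.le, Real.rpow_natCast]
  have h3 : (1 + (A * Aᵀ)⁻¹ * (M₀ + A * Z * B - M₀) * (Bᵀ * B)⁻¹ * (M₀ + A * Z * B - M₀)ᵀ).det =
      (1 + Zᵀ * Z).det := by
    have e : (A * Aᵀ)⁻¹ * (M₀ + A * Z * B - M₀) * (Bᵀ * B)⁻¹ * (M₀ + A * Z * B - M₀)ᵀ =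
        (Aᵀ)⁻¹ * (Z * Zᵀ * Aᵀ) := by
      rw [add_sub_cancel_left, Matrix.mul_inv_rev, Matrix.mul_inv_rev, transpose_mul,
        transpose_mul]
      calc (Aᵀ)⁻¹ * A⁻¹ * (A * Z * B) * (B⁻¹ * (Bᵀ)⁻¹) * (Bᵀ * (Zᵀ * Aᵀ))
          = (Aᵀ)⁻¹ * (A⁻¹ * A) * Z * (B * B⁻¹) * ((Bᵀ)⁻¹ * Bᵀ) * (Zᵀ * Aᵀ) := by
            simp only [Matrix.mul_assoc]
        _ = _ := by
            rw [nonsing_inv_mul _ hA, mul_nonsing_inv _ hB, nonsing_inv_mul _ hBt]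
            simp only [Matrix.mul_one, Matrix.mul_assoc]
    rw [e, det_one_add_mul_comm, Matrix.mul_assoc, mul_nonsing_inv _ hAt, Matrix.mul_one,
      det_one_add_mul_comm]
  rw [matrixTPDF_standard, matrixTPDF, h1, h2, h3, tConst, abs_mul, abs_pow, abs_pow]
  field_simp

/-- The matrix-T distribution is an affine image of the standard one. -/
theorem matrixT_eq_map (M₀ : Matrix (Fin p) (Fin n) ℝ) {A : Matrix (Fin p) (Fin p) ℝ}
    {B : Matrix (Fin n) (Fin n) ℝ} (hA : IsUnit A.det) (hB : IsUnit B.det) (κ : ℝ) :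
    matrixT M₀ (A * Aᵀ) (Bᵀ * B) κ =
      (matrixT (0 : Matrix (Fin p) (Fin n) ℝ) 1 1 κ).map
        fun Z => Matrix.of.symm M₀ + sandwich A B Z := by
  have hL : LinearMap.det (sandwich A B) ≠ 0 := by
    rw [det_sandwich]
    exact mul_ne_zero (pow_ne_zero _ hA.ne_zero) (pow_ne_zero _ hB.ne_zero)
  refine Measure.ext_of_lintegral _ fun f hf => ?_
  have hm := (measurable_matrixTPDF M₀ (A * Aᵀ) (Bᵀ * B) κ).ennreal_ofReal
  have hφ : Measurable fun Z : Fin p → Fin n → ℝ => Matrix.of.symm M₀ + sandwich A B Z :=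
    (measurable_sandwich A B).const_add _
  rw [lintegral_map hf hφ, matrixT, matrixT, lintegral_withDensity_eq_lintegral_mul _ hm hf]
  refine Eq.trans ?_ (lintegral_withDensity_eq_lintegral_mul volume
    (measurable_matrixTPDF 0 1 1 κ).ennreal_ofReal (hf.comp hφ)).symm
  rw [← lintegral_add_left_eq_self _ (Matrix.of.symm M₀)]
  refine (lintegral_comp_linearMap volume hL
    ((hm.mul hf).comp (measurable_const_add (Matrix.of.symm M₀)))).trans ?_
  rw [← lintegral_const_mul' _ _ ENNReal.ofReal_ne_top]
  congr 1
  funext Z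
  simp only [Pi.mul_apply, Function.comp_apply]
  rw [← mul_assoc, ← ENNReal.ofReal_mul (abs_nonneg _), det_sandwich,
    ← matrixTPDF_sandwich M₀ hA hB κ]
  rfl

theorem exists_matrixT_eq_map (M₀ : Matrix (Fin p) (Fin n) ℝ) {S : Matrix (Fin p) (Fin p) ℝ}
    {W : Matrix (Fin n) (Fin n) ℝ} (hS : S.PosDef) (hW : W.PosDef) (κ : ℝ) :
    ∃ (A : Matrix (Fin p) (Fin p) ℝ) (B : Matrix (Fin n) (Fin n) ℝ), S = A * Aᵀ ∧ W = Bᵀ * B ∧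
      matrixT M₀ S W κ = (matrixT (0 : Matrix (Fin p) (Fin n) ℝ) 1 1 κ).map
        fun Z => Matrix.of.symm M₀ + sandwich A B Z := by
  obtain ⟨A, hA, rfl⟩ := exists_eq_mul_transpose_of_posDef hS
  obtain ⟨G, hG, rfl⟩ := exists_eq_mul_transpose_of_posDef hW
  have hGt : IsUnit Gᵀ.det := by simpa using hG
  refine ⟨A, Gᵀ, rfl, by rw [transpose_transpose], ?_⟩
  have := matrixT_eq_map M₀ hA hGt κ
  rwa [transpose_transpose] at this

theorem isProbabilityMeasure_matrixT (M₀ : Matrix (Fin p) (Fin n) ℝ)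
    {S : Matrix (Fin p) (Fin p) ℝ} {W : Matrix (Fin n) (Fin n) ℝ} (hS : S.PosDef)
    (hW : W.PosDef) (hκ : 0 < κ) : IsProbabilityMeasure (matrixT M₀ S W κ) := by
  obtain ⟨A, B, -, -, h⟩ := exists_matrixT_eq_map M₀ hS hW κ
  have := isProbabilityMeasure_matrixT_standard p n hκ
  rw [h]
  exact Measure.isProbabilityMeasure_map ((measurable_sandwich A B).const_add _).aemeasurable

theorem matrixT_absolutelyContinuous (M₀ : Matrix (Fin p) (Fin n) ℝ)
    (S : Matrix (Fin p) (Fin p) ℝ) (W : Matrix (Fin n) (Fin n) ℝ) (κ : ℝ) :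
    matrixT M₀ S W κ ≪ volume :=
  withDensity_absolutelyContinuous _ _

end MatrixT

/-! ### Second moments of the standard matrix-T law -/

section Moments

variable {p n : ℕ} {κ : ℝ}

theorem lintegral_sq_coord_eq (b : ℝ) (i j : Fin n) :
    ∫⁻ z : Fin n → ℝ, ENNReal.ofReal (z i ^ 2 * (1 + z ⬝ᵥ z) ^ (-b)) =
      ∫⁻ z : Fin n → ℝ, ENNReal.ofReal (z j ^ 2 * (1 + z ⬝ᵥ z) ^ (-b)) := by
  have h := volume_measurePreserving_piCongrLeft (fun _ : Fin n => ℝ) (Equiv.swap i j)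
  have hm : Measurable fun z : Fin n → ℝ =>
      ENNReal.ofReal (z i ^ 2 * (1 + z ⬝ᵥ z) ^ (-b)) := by
    unfold dotProduct; fun_prop
  rw [← h.lintegral_comp hm]
  congr 1
  funext z
  have hz : ∀ k, MeasurableEquiv.piCongrLeft (fun _ : Fin n => ℝ) (Equiv.swap i j) z k =
      z (Equiv.swap i j k) := by
    intro k
    obtain ⟨l, rfl⟩ := (Equiv.swap i j).surjective k
    have hl : Equiv.swap i j (Equiv.swap i j l) = l := by simp
    rw [hl]
    exact Equiv.piCongrLeft_apply_apply (fun _ : Fin n => ℝ) _ z l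
  rw [hz, Equiv.swap_apply_left]
  congr 4
  simp only [dotProduct, hz]
  exact Equiv.sum_comp (Equiv.swap i j) fun k => z k * z k

theorem studentConst_sub_one {b : ℝ} (hb : (n : ℝ) / 2 + 1 < b) :
    studentConst n (b - 1) = studentConst n b * (1 + n / (2 * b - n - 2)) := by
  have hn0 : (0 : ℝ) ≤ n / 2 := by positivity
  have h1 : Real.Gamma b = (b - 1) * Real.Gamma (b - 1) := by
    have := Real.Gamma_add_one (s := b - 1) (by linarith)
    rwa [sub_add_cancel] at this
  have h2 : Real.Gamma (b - n / 2) = (b - 1 - n / 2) * Real.Gamma (b - 1 - n / 2) := by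
    have := Real.Gamma_add_one (s := b - 1 - n / 2) (by linarith)
    rwa [show b - 1 - (n : ℝ) / 2 + 1 = b - n / 2 by ring] at this
  have h3 : 0 < Real.Gamma (b - 1) := Real.Gamma_pos_of_pos (by linarith)
  have h4 : 2 * b - n - 2 ≠ 0 := by linarith
  have h5 : b - 1 ≠ 0 := by linarith
  have h6 : b - 1 - n / 2 = (2 * b - n - 2) / 2 := by ring
  rw [studentConst, studentConst, h1, h2]
  generalize Real.Gamma (b - 1 - n / 2) = g
  rw [h6]
  field_simp
  ring

/-- By symmetry the n coordinates contribute equally, and their sum plus the integral of (1 +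
|z|²)^{-b} is the integral of (1 + |z|²)^{-(b-1)}. The Gamma recursion evaluates the difference. -/
theorem lintegral_sq_coord {b : ℝ} (hb : (n : ℝ) / 2 + 1 < b) (i : Fin n) :
    ∫⁻ z : Fin n → ℝ, ENNReal.ofReal (z i ^ 2 * (1 + z ⬝ᵥ z) ^ (-b)) =
      ENNReal.ofReal (studentConst n b / (2 * b - n - 2)) := by
  have hn : (0 : ℝ) < n := by exact_mod_cast i.pos
  have hs := studentConst_pos (n := n) (a := b) (by linarith)
  have hk : 0 < 2 * b - n - 2 := by linarith
  have hsum : (∑ j : Fin n, ∫⁻ z : Fin n → ℝ, ENNReal.ofReal (z j ^ 2 * (1 + z ⬝ᵥ z) ^ (-b))) +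
      ENNReal.ofReal (studentConst n b) = ENNReal.ofReal (studentConst n (b - 1)) := by
    rw [← lintegral_one_add_dotProduct_rpow (by linarith : (n : ℝ) / 2 < b),
      ← lintegral_one_add_dotProduct_rpow (by linarith : (n : ℝ) / 2 < b - 1),
      ← lintegral_finsetSum _ (fun j _ => by unfold dotProduct; fun_prop),
      ← lintegral_add_right _ (by unfold dotProduct; fun_prop)]
    congr 1
    funext z
    have hz := dotProduct_self_nonneg' z
    rw [← ENNReal.ofReal_sum_of_nonneg (fun j _ => by positivity), ← Finset.sum_mul,
      ← ENNReal.ofReal_add (mul_nonneg (Finset.sum_nonneg fun j _ => sq_nonneg _) (by positivity))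
        (by positivity)]
    congr 1
    have h1 : ∑ j, z j ^ 2 = z ⬝ᵥ z := Finset.sum_congr rfl fun j _ => sq (z j)
    rw [h1, show -(b - 1) = -b + 1 by ring, Real.rpow_add (by linarith), Real.rpow_one]
    ring
  rw [Finset.sum_congr rfl fun j _ => lintegral_sq_coord_eq b j i, Finset.sum_const,
    Finset.card_univ, Fintype.card_fin, nsmul_eq_mul, studentConst_sub_one hb, mul_add, mul_one,
    add_comm, ENNReal.ofReal_add hs.le (by positivity)] at hsum
  have h2 := (ENNReal.add_right_inj ENNReal.ofReal_ne_top).1 hsum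
  rw [show studentConst n b * (n / (2 * b - n - 2)) =
    n * (studentConst n b / (2 * b - n - 2)) by ring, ENNReal.ofReal_mul hn.le,
    ENNReal.ofReal_natCast] at h2
  exact (ENNReal.mul_right_inj (by simpa using i.pos.ne') (ENNReal.natCast_ne_top n)).1 h2

theorem lintegral_sq_entry_matrixT (hκ : 2 < κ) (i : Fin p) (a : Fin n) :
    ∫⁻ Z, ENNReal.ofReal (Z i a ^ 2) ∂(matrixT (0 : Matrix (Fin p) (Fin n) ℝ) 1 1 κ) =
      ENNReal.ofReal (1 / (κ - 2)) := by
  obtain ⟨q, rfl⟩ : ∃ q, p = q + 1 := ⟨p - 1, by have := i.pos; omega⟩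
  have hκ0 : 0 < κ := by linarith
  have hc := tConst_pos (p := q + 1) (n := n) hκ0
  have hc1 := tConst_mul_prod_studentConst (p := q + 1) (n := n) hκ0
  rw [matrixT, lintegral_withDensity_eq_lintegral_mul _
    (measurable_matrixTPDF 0 1 1 κ).ennreal_ofReal (by fun_prop)]
  simp only [Pi.mul_apply, matrixTPDF_standard, ENNReal.ofReal_mul hc.le]
  set e := (κ + n + (q + 1 : ℕ) - 1) / 2 with he
  -- Integrating out the other q rows leaves the exponent b = (κ + n)/2 for row i, so that 2b - n -
  -- 2 = κ - 2.
  have he' : e - (q : ℝ) / 2 = (κ + n) / 2 := by rw [he]; push_cast; ring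
  have h1 := lintegral_row_mul_det_one_add_gram_rpow (p := q) (n := n) (a := e)
    (by rw [he]; push_cast; linarith) i (h := fun z => ENNReal.ofReal (z a ^ 2)) (by fun_prop)
  simp only [mul_assoc, mul_comm (ENNReal.ofReal (_ ^ (-e)))]
  rw [lintegral_const_mul' _ _ ENNReal.ofReal_ne_top, h1]
  simp only [← ENNReal.ofReal_mul (sq_nonneg _)]
  rw [he', lintegral_sq_coord (by linarith)]
  have hprod : 0 ≤ ∏ k ∈ Finset.range q, studentConst n (e - (k : ℝ) / 2) := by
    refine Finset.prod_nonneg fun k hk => (studentConst_pos ?_).le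
    have : (k : ℝ) ≤ q := by exact_mod_cast (Finset.mem_range.1 hk).le
    rw [he]; push_cast; linarith
  rw [Finset.prod_range_succ, he'] at hc1
  rw [← ENNReal.ofReal_mul hprod, ← ENNReal.ofReal_mul hc.le]
  congr 1
  rw [← hc1]
  ring_nf

theorem integrable_mul_entries_matrixT (hκ : 2 < κ) (i j : Fin p) (a b : Fin n) :
    Integrable (fun Z => Z i a * Z j b) (matrixT (0 : Matrix (Fin p) (Fin n) ℝ) 1 1 κ) := by
  have hsq : ∀ (i : Fin p) (a : Fin n), Integrable (fun Z => Z i a ^ 2)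
      (matrixT (0 : Matrix (Fin p) (Fin n) ℝ) 1 1 κ) := by
    intro i a
    refine ⟨(by fun_prop : Measurable fun Z : Fin p → Fin n → ℝ => Z i a ^ 2).aestronglyMeasurable,
      ?_⟩
    rw [hasFiniteIntegral_iff_ofReal (Filter.Eventually.of_forall fun _ => sq_nonneg _),
      lintegral_sq_entry_matrixT hκ]
    exact ENNReal.ofReal_lt_top
  refine ((hsq i a).add (hsq j b)).mono' (by fun_prop) (Filter.Eventually.of_forall fun Z => ?_)
  rw [Real.norm_eq_abs, abs_le, Pi.add_apply]
  constructor <;> nlinarith [sq_nonneg (Z i a + Z j b), sq_nonneg (Z i a - Z j b),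
    sq_nonneg (Z i a), sq_nonneg (Z j b)]

theorem integral_sq_entry_matrixT (hκ : 2 < κ) (i : Fin p) (a : Fin n) :
    ∫ Z, Z i a * Z i a ∂(matrixT (0 : Matrix (Fin p) (Fin n) ℝ) 1 1 κ) = 1 / (κ - 2) := by
  have hk : 0 < κ - 2 := by linarith
  rw [integral_eq_lintegral_of_nonneg_ae (Filter.Eventually.of_forall fun _ => mul_self_nonneg _)
    (by fun_prop)]
  simp only [← sq]
  rw [lintegral_sq_entry_matrixT hκ, ENNReal.toReal_ofReal (by positivity)]

/-- Changing the signs of rows and columns preserves the standard matrix-T distribution. -/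
theorem integral_mul_entries_sign (κ : ℝ) {σ : Fin p → ℝ} {τ : Fin n → ℝ}
    (hσ : ∀ k, σ k * σ k = 1) (hτ : ∀ k, τ k * τ k = 1) (i j : Fin p) (a b : Fin n) :
    ∫ Z, Z i a * Z j b ∂(matrixT (0 : Matrix (Fin p) (Fin n) ℝ) 1 1 κ) =
      (σ i * τ a) * (σ j * τ b) *
        ∫ Z, Z i a * Z j b ∂(matrixT (0 : Matrix (Fin p) (Fin n) ℝ) 1 1 κ) := by
  have hA : diagonal σ * (diagonal σ)ᵀ = 1 := by
    rw [diagonal_transpose, diagonal_mul_diagonal, ← diagonal_one]; simp only [hσ]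
  have hB : (diagonal τ)ᵀ * diagonal τ = 1 := by
    rw [diagonal_transpose, diagonal_mul_diagonal, ← diagonal_one]; simp only [hτ]
  have h := matrixT_eq_map (0 : Matrix (Fin p) (Fin n) ℝ)
    (isUnit_det_of_right_inverse hA) (isUnit_det_of_left_inverse hB) κ
  rw [hA, hB] at h
  conv_lhs => rw [h]
  rw [integral_map ((measurable_sandwich _ _).const_add _).aemeasurable (by fun_prop),
    ← integral_const_mul]
  congr 1
  funext Z
  have hs : ∀ k c, (Matrix.of.symm (0 : Matrix (Fin p) (Fin n) ℝ) +
      sandwich (diagonal σ) (diagonal τ) Z) k c = σ k * Z k c * τ c := by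
    intro k c
    change (0 : ℝ) + (diagonal σ * Matrix.of Z * diagonal τ) k c = _
    rw [zero_add, mul_diagonal, diagonal_mul, of_apply]
  rw [hs, hs]
  ring

/-- For distinct entries, flipping the sign of a row or column containing exactly one of them
preserves the law and negates the moment. -/
theorem integral_mul_entries_matrixT (hκ : 2 < κ) (i j : Fin p) (a b : Fin n) :
    ∫ Z, Z i a * Z j b ∂(matrixT (0 : Matrix (Fin p) (Fin n) ℝ) 1 1 κ) =
      if i = j ∧ a = b then 1 / (κ - 2) else 0 := by
  split_ifs with h
  · obtain ⟨rfl, rfl⟩ := h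
    exact integral_sq_entry_matrixT hκ i a
  · have hflip : ∀ {m : ℕ} (c k : Fin m), (if k = c then (-1 : ℝ) else 1) *
        (if k = c then (-1 : ℝ) else 1) = 1 := by
      intro m c k; split_ifs <;> norm_num
    by_cases hij : i = j
    · have hab : b ≠ a := fun hab => h ⟨hij, hab.symm⟩
      have := integral_mul_entries_sign κ (σ := fun _ => 1)
        (τ := fun k => if k = a then -1 else 1) (fun _ => one_mul 1) (hflip a) i j a b
      rw [if_pos rfl, if_neg hab] at this
      linarith
    · have := integral_mul_entries_sign κ (τ := fun _ => 1)
        (σ := fun k => if k = i then -1 else 1) (hflip i) (fun _ => one_mul 1) i j a b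
      rw [if_pos rfl, if_neg (Ne.symm hij)] at this
      linarith

theorem integrable_quadratic_matrixT (hκ : 2 < κ) (C : Matrix (Fin n) (Fin n) ℝ) (i j : Fin p) :
    Integrable (fun Z : Fin p → Fin n → ℝ => (Matrix.of Z * C * (Matrix.of Z)ᵀ) i j)
      (matrixT (0 : Matrix (Fin p) (Fin n) ℝ) 1 1 κ) := by
  have : (fun Z : Fin p → Fin n → ℝ => (Matrix.of Z * C * (Matrix.of Z)ᵀ) i j) =
      fun Z => ∑ b, ∑ a, C a b * (Z i a * Z j b) := by
    funext Z
    simp only [Matrix.mul_apply, transpose_apply, of_apply, Finset.sum_mul]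
    exact Finset.sum_congr rfl fun b _ => Finset.sum_congr rfl fun a _ => by ring
  rw [this]
  exact integrable_finsetSum _ fun b _ => integrable_finsetSum _ fun a _ =>
    (integrable_mul_entries_matrixT hκ i j a b).const_mul _

theorem integral_quadratic_matrixT (hκ : 2 < κ) (C : Matrix (Fin n) (Fin n) ℝ) (i j : Fin p) :
    ∫ Z, (Matrix.of Z * C * (Matrix.of Z)ᵀ) i j
        ∂(matrixT (0 : Matrix (Fin p) (Fin n) ℝ) 1 1 κ) =
      C.trace / (κ - 2) * (1 : Matrix (Fin p) (Fin p) ℝ) i j := by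
  have : (fun Z : Fin p → Fin n → ℝ => (Matrix.of Z * C * (Matrix.of Z)ᵀ) i j) =
      fun Z => ∑ b, ∑ a, C a b * (Z i a * Z j b) := by
    funext Z
    simp only [Matrix.mul_apply, transpose_apply, of_apply, Finset.sum_mul]
    exact Finset.sum_congr rfl fun b _ => Finset.sum_congr rfl fun a _ => by ring
  rw [this, integral_finsetSum _ fun b _ => integrable_finsetSum _ fun a _ =>
    (integrable_mul_entries_matrixT hκ i j a b).const_mul _]
  have h1 : ∀ b, ∫ Z, ∑ a, C a b * (Z i a * Z j b)
      ∂(matrixT (0 : Matrix (Fin p) (Fin n) ℝ) 1 1 κ) =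
      if i = j then C b b * (1 / (κ - 2)) else 0 := by
    intro b
    rw [integral_finsetSum _ fun a _ => (integrable_mul_entries_matrixT hκ i j a b).const_mul _]
    simp only [integral_const_mul, integral_mul_entries_matrixT hκ]
    by_cases hij : i = j <;> simp [hij]
  simp only [h1]
  by_cases hij : i = j
  · subst hij
    simp only [if_true, one_apply_eq, mul_one, ← Finset.sum_mul, Matrix.trace, diag_apply]
    ring
  · simp [hij]

end Moments

/-! ### Almost sure nonsingularity -/

section NullSet

theorem finite_setOf_det_quadratic_eq_zero {p : ℕ} (A B : Matrix (Fin p) (Fin p) ℝ)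
    {C : Matrix (Fin p) (Fin p) ℝ} (hC : C.det ≠ 0) :
    {t : ℝ | (A + t • B + t ^ 2 • C).det = 0}.Finite := by
  -- The reversed polynomial in s = 1/t: its value at s = 0 is det C, so it is nonzero, and its
  -- roots capture every t ≠ 0 in the set.
  set r : Polynomial ℝ := ((Polynomial.X : Polynomial ℝ) ^ 2 • A.map Polynomial.C +
    (Polynomial.X : Polynomial ℝ) • B.map Polynomial.C + C.map Polynomial.C).det with hr
  have heval : ∀ s : ℝ, r.eval s = (s ^ 2 • A + s • B + C).det := by
    intro s
    rw [hr, ← Polynomial.coe_evalRingHom, RingHom.map_det]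
    congr 1
    ext i j
    simp
    ring
  have hr0 : r ≠ 0 := by
    intro h
    apply hC
    have := heval 0
    rw [h] at this
    simpa using this.symm
  refine ((r.roots.toFinset.finite_toSet.image Inv.inv).union (Set.finite_singleton 0)).subset ?_
  intro t ht
  by_cases h0 : t = 0
  · exact Or.inr h0
  · refine Or.inl ⟨t⁻¹, ?_, inv_inv t⟩
    rw [Finset.mem_coe, Multiset.mem_toFinset, Polynomial.mem_roots hr0, Polynomial.IsRoot.def,
      heval]
    have h1 : (t⁻¹) ^ 2 • A + t⁻¹ • B + C = (t⁻¹) ^ 2 • (A + t • B + t ^ 2 • C) := by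
      rw [smul_add, smul_add, smul_smul, smul_smul]
      congr 2
      · congr 1; field_simp
      · rw [← mul_pow, inv_mul_cancel₀ h0, one_pow, one_smul]
    rw [h1, det_smul, show (A + t • B + t ^ 2 • C).det = 0 from ht, mul_zero]

/-- If the quadratic form `Y ↦ Y Q Yᵀ` is nonsingular somewhere, it is so almost everywhere. -/
theorem ae_det_quadratic_ne_zero {p n : ℕ} (Q : Matrix (Fin n) (Fin n) ℝ)
    {V : Matrix (Fin p) (Fin n) ℝ} (hV : (V * Q * Vᵀ).det ≠ 0) :
    ∀ᵐ Y : Fin p → Fin n → ℝ, (Matrix.of Y * Q * (Matrix.of Y)ᵀ).det ≠ 0 := by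
  have hof : Continuous fun Z : Fin p → Fin n → ℝ => (Matrix.of Z : Matrix (Fin p) (Fin n) ℝ) :=
    continuous_id
  have hc : Continuous fun Y : Fin p → Fin n → ℝ =>
      (Matrix.of Y * Q * (Matrix.of Y)ᵀ).det := by fun_prop
  have hs : MeasurableSet {Y : Fin p → Fin n → ℝ |
      (Matrix.of Y * Q * (Matrix.of Y)ᵀ).det ≠ 0} :=
    (isOpen_ne_fun hc continuous_const).measurableSet
  -- It suffices to check almost every point of each line parallel to V, where the determinant is
  -- that of a quadratic in t with leading coefficient VQVᵀ.
  refine ae_mem_of_ae_add_linearMap_mem (LinearMap.toSpanSingleton ℝ (Fin p → Fin n → ℝ)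
    (Matrix.of.symm V)) volume volume hs fun Y => ?_
  have hfin := finite_setOf_det_quadratic_eq_zero (Matrix.of Y * Q * (Matrix.of Y)ᵀ)
    (Matrix.of Y * Q * Vᵀ + V * Q * (Matrix.of Y)ᵀ) hV
  filter_upwards [compl_mem_ae_iff.2 (hfin.measure_zero volume)] with t ht
  intro h0
  apply ht
  have : (Matrix.of (Y + LinearMap.toSpanSingleton ℝ (Fin p → Fin n → ℝ)
      (Matrix.of.symm V) t) : Matrix (Fin p) (Fin n) ℝ) = Matrix.of Y + t • V := rfl
  rw [this] at h0
  rw [Set.mem_ofPred_eq, ← h0]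
  congr 1
  simp only [transpose_add, transpose_smul, Matrix.add_mul, Matrix.mul_add, Matrix.smul_mul,
    Matrix.mul_smul, smul_add, smul_smul, sq]
  abel

variable {p d N : ℕ} {Φ : Matrix (Fin d) (Fin N) ℝ} {δ : Fin N → ℝ}

/-- The kernel of ΦD^{-1/2} has dimension at least N - d ≥ p. If the rows of v are p independent
vectors in it, V = vD^{1/2} gives VQVᵀ = vPvᵀ = vvᵀ. -/
theorem exists_posDef_quadratic (hΦ : Φ.rank = d) (hδ : ∀ i, 0 < δ i) (hN : d + p ≤ N) :
    ∃ V : Matrix (Fin p) (Fin N) ℝ, (V * precisionProj Φ δ * Vᵀ).PosDef := by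
  have hrank := (Φ * noiseInvSqrt δ).mulVecLin.finrank_range_add_finrank_ker
  have hle : (Φ * noiseInvSqrt δ).rank ≤ d := by simpa using rank_le_height (Φ * noiseInvSqrt δ)
  rw [Module.finrank_fin_fun] at hrank
  have hker : p ≤ Module.finrank ℝ (LinearMap.ker (Φ * noiseInvSqrt δ).mulVecLin) := by
    have : Module.finrank ℝ (LinearMap.range (Φ * noiseInvSqrt δ).mulVecLin) ≤ d := hle
    omega
  set b := Module.finBasis ℝ (LinearMap.ker (Φ * noiseInvSqrt δ).mulVecLin)
  let v : Fin p → Fin N → ℝ := fun i => (b (Fin.castLE hker i) : Fin N → ℝ)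
  have hv : LinearIndependent ℝ v :=
    (b.linearIndependent.map' (Submodule.subtype _) (Submodule.ker_subtype _)).comp _
      (Fin.castLE_injective hker)
  have hPv : ∀ i, proj Φ δ *ᵥ v i = v i := fun i =>
    (proj_mulVec_eq_self_iff hΦ hδ _).2 (b (Fin.castLE hker i)).2
  have hPV : proj Φ δ * (Matrix.of v)ᵀ = (Matrix.of v)ᵀ := by
    ext a i
    exact congrFun (hPv i) a
  -- The product D · D^{-1/2} plays the role of D^{1/2}.
  refine ⟨Matrix.of v * (noiseCov δ * noiseInvSqrt δ), ?_⟩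
  have h1 : Matrix.of v * (noiseCov δ * noiseInvSqrt δ) * precisionProj Φ δ *
      (Matrix.of v * (noiseCov δ * noiseInvSqrt δ))ᵀ = Matrix.of v * (Matrix.of v)ᵀ := by
    rw [transpose_mul, transpose_mul, transpose_noiseInvSqrt,
      transpose_eq_of_posSemidef (posDef_noiseCov hδ).posSemidef, precisionProj]
    calc _ = Matrix.of v * (noiseCov δ * (noiseInvSqrt δ * noiseInvSqrt δ)) * (proj Φ δ *
          ((noiseInvSqrt δ * noiseInvSqrt δ * noiseCov δ) * (Matrix.of v)ᵀ)) := by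
          simp only [Matrix.mul_assoc]
      _ = _ := by
          rw [noiseCov_mul_inv_sq hδ, inv_sq_mul_noiseCov hδ, Matrix.one_mul, Matrix.mul_one, hPV]
  rw [h1]
  exact posDef_mul_transpose (vecMul_injective_iff.2 hv)

end NullSet

/-! ### The evidence: density, definiteness and mean of Ψ̂ -/

section Evidence

variable {p d N : ℕ} {Φ : Matrix (Fin d) (Fin N) ℝ} {δ : Fin N → ℝ} {ν : ℝ}

theorem isProbabilityMeasure_evidence (hδ : ∀ i, 0 < δ i) (hν : 2 * (p : ℝ) < ν)
    (M : Matrix (Fin p) (Fin d) ℝ) {K : Matrix (Fin d) (Fin d) ℝ} {Ψ : Matrix (Fin p) (Fin p) ℝ}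
    (hK : K.PosDef) (hΨ : Ψ.PosDef) : IsProbabilityMeasure (evidence Φ δ ν M K Ψ) :=
  isProbabilityMeasure_matrixT _ hΨ (posDef_Om hδ hK.posSemidef) (sub_pos.2 hν)

theorem loss_eq_neg_log_matrixTPDF (hδ : ∀ i, 0 < δ i) (hν : 2 * (p : ℝ) < ν)
    (M : Matrix (Fin p) (Fin d) ℝ) {K : Matrix (Fin d) (Fin d) ℝ} {Ψ : Matrix (Fin p) (Fin p) ℝ}
    (hK : K.PosDef) (hΨ : Ψ.PosDef) (Y : Matrix (Fin p) (Fin N) ℝ) :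
    loss Φ δ ν Y M K Ψ = -Real.log (matrixTPDF (M * Φ) Ψ (Om Φ δ K) (ν - 2 * p) Y) := by
  have hΩ := posDef_Om (Φ := Φ) hδ hK.posSemidef
  have hH : (Hmat Φ δ Y M K Ψ).PosDef :=
    hΨ.add_posSemidef (posSemidef_mul_mul_transpose hΩ.inv.posSemidef _)
  have hC := tConst_pos (p := p) (n := N) (sub_pos.2 hν)
  have e1 : ν - 2 * p + N + p - 1 = nuP p ν + N := by rw [nuP]; ring
  have e2 : ν - 2 * p + p - 1 = nuP p ν := by rw [nuP]; ring
  -- Factoring out Ψ⁻¹ turns the determinant into |H|/|Ψ|, which changes the power of |Ψ| from -N/2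
  -- to ν'/2.
  have hdet : (1 + Ψ⁻¹ * (Y - M * Φ) * (Om Φ δ K)⁻¹ * (Y - M * Φ)ᵀ).det =
      (Hmat Φ δ Y M K Ψ).det / Ψ.det := by
    have : Hmat Φ δ Y M K Ψ =
        Ψ * (1 + Ψ⁻¹ * (Y - M * Φ) * (Om Φ δ K)⁻¹ * (Y - M * Φ)ᵀ) := by
      rw [Matrix.mul_add, Matrix.mul_one, Hmat, resid]
      simp only [← Matrix.mul_assoc]
      rw [mul_nonsing_inv _ (isUnit_det_of_posDef hΨ), Matrix.one_mul]
    rw [this, det_mul, mul_div_cancel_left₀ _ hΨ.det_pos.ne']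
  have hΨd := hΨ.det_pos
  have hΩd := hΩ.det_pos
  have hHd := hH.det_pos
  rw [tConst, e1, e2] at hC
  rw [matrixTPDF, e1, e2, hdet, Real.log_mul (by positivity) (by positivity),
    Real.log_mul (by positivity) (by positivity), Real.log_mul hC.ne' (by positivity),
    Real.log_rpow hΨd, Real.log_rpow hΩd, Real.log_rpow (by positivity),
    Real.log_div hHd.ne' hΨd.ne', loss, normConst]
  ring

theorem ae_posDef_Psihat (hp : 0 < p) (hΦ : Φ.rank = d) (hδ : ∀ i, 0 < δ i)
    (hν : 2 * (p : ℝ) < ν) (hN : d + p ≤ N) (M : Matrix (Fin p) (Fin d) ℝ)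
    (K : Matrix (Fin d) (Fin d) ℝ) (Ψ : Matrix (Fin p) (Fin p) ℝ) :
    ∀ᵐ Y ∂(evidence Φ δ ν M K Ψ), (Psihat Φ δ ν (Matrix.of Y)).PosDef := by
  obtain ⟨V, hV⟩ := exists_posDef_quadratic (p := p) hΦ hδ hN
  refine (matrixT_absolutelyContinuous _ _ _ _).ae_le ?_
  filter_upwards [ae_det_quadratic_ne_zero _ hV.det_pos.ne'] with Y hY
  rw [Psihat_eq]
  have hN0 : (0 : ℝ) < N := by exact_mod_cast (by omega : 0 < N)
  exact (((posSemidef_mul_mul_transpose (posSemidef_precisionProj hΦ hδ) _).posDef_iff_det_ne_zero).2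
    hY).smul (div_pos (nuP_pos hp hν) hN0)

/-- For Y = MΦ + AZB with Ψ = AAᵀ and Ω = BᵀB, the mean drops out and YQYᵀ = A(ZCZᵀ)Aᵀ with C =
BQBᵀ. Its expectation is tr(C)/(κ - 2) · AAᵀ, where tr C = tr(QΩ) = N - d and κ - 2 = ν' - p - 1. -/
theorem integrable_and_integral_Psihat (hΦ : Φ.rank = d) (hδ : ∀ i, 0 < δ i)
    (hν : 2 * (p : ℝ) + 2 < ν) (M : Matrix (Fin p) (Fin d) ℝ) {K : Matrix (Fin d) (Fin d) ℝ}
    {Ψ : Matrix (Fin p) (Fin p) ℝ} (hK : K.PosDef) (hΨ : Ψ.PosDef) (i j : Fin p) :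
    Integrable (fun Y : Fin p → Fin N → ℝ => Psihat Φ δ ν (Matrix.of Y) i j)
      (evidence Φ δ ν M K Ψ) ∧
    ∫ Y, Psihat Φ δ ν (Matrix.of Y) i j ∂(evidence Φ δ ν M K Ψ) =
      ((N : ℝ) - d) / N * (nuP p ν / (nuP p ν - p - 1)) * Ψ i j := by
  have hκ : 2 < ν - 2 * (p : ℝ) := by linarith
  obtain ⟨A, B, hA, hB, h⟩ := exists_matrixT_eq_map (M * Φ) hΨ
    (posDef_Om (Φ := Φ) hδ hK.posSemidef) (ν - 2 * p)
  have hmeas : Measurable fun Y : Fin p → Fin N → ℝ => Psihat Φ δ ν (Matrix.of Y) i j := by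
    have hof : Continuous fun Z : Fin p → Fin N → ℝ => (Matrix.of Z : Matrix (Fin p) (Fin N) ℝ) :=
      continuous_id
    have : Continuous fun Y : Fin p → Fin N → ℝ => Psihat Φ δ ν (Matrix.of Y) := by
      unfold Psihat; fun_prop
    exact (this.matrix_elem i j).measurable
  have hφ : Measurable fun Z : Fin p → Fin N → ℝ => Matrix.of.symm (M * Φ) + sandwich A B Z :=
    (measurable_sandwich A B).const_add _
  set C := B * precisionProj Φ δ * Bᵀ with hC
  have hPsi : ∀ Z : Fin p → Fin N → ℝ,
      Psihat Φ δ ν (Matrix.of (Matrix.of.symm (M * Φ) + sandwich A B Z)) i j =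
      nuP p ν / N * ∑ l, ∑ k, A i k * A j l * (Matrix.of Z * C * (Matrix.of Z)ᵀ) k l := by
    intro Z
    have hof : (Matrix.of (Matrix.of.symm (M * Φ) + sandwich A B Z) : Matrix (Fin p) (Fin N) ℝ) =
        M * Φ + A * Matrix.of Z * B := rfl
    have hq : (M * Φ + A * Matrix.of Z * B) * precisionProj Φ δ *
        (M * Φ + A * Matrix.of Z * B)ᵀ = A * (Matrix.of Z * C * (Matrix.of Z)ᵀ) * Aᵀ := by
      have h1 : (M * Φ + A * Matrix.of Z * B) * precisionProj Φ δ =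
          A * Matrix.of Z * B * precisionProj Φ δ := by
        rw [Matrix.add_mul, Matrix.mul_assoc M, mul_precisionProj hΦ hδ, Matrix.mul_zero, zero_add]
      have h2 : precisionProj Φ δ * (M * Φ)ᵀ = 0 := by
        rw [transpose_mul, ← Matrix.mul_assoc, precisionProj_mul_transpose hΦ hδ, Matrix.zero_mul]
      rw [h1, transpose_add, Matrix.mul_add, Matrix.mul_assoc _ (precisionProj Φ δ), h2,
        Matrix.mul_zero, zero_add, hC, transpose_mul, transpose_mul]
      simp only [Matrix.mul_assoc]
    rw [hof, Psihat_eq, hq, Matrix.smul_apply, smul_eq_mul, Matrix.mul_apply]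
    congr 1
    refine Finset.sum_congr rfl fun l _ => ?_
    rw [Matrix.mul_apply, Finset.sum_mul]
    exact Finset.sum_congr rfl fun k _ => by rw [transpose_apply]; ring
  have hint : ∀ k l, Integrable (fun Z : Fin p → Fin N → ℝ =>
      A i k * A j l * (Matrix.of Z * C * (Matrix.of Z)ᵀ) k l)
      (matrixT (0 : Matrix (Fin p) (Fin N) ℝ) 1 1 (ν - 2 * p)) := fun k l =>
    (integrable_quadratic_matrixT hκ C k l).const_mul _
  rw [evidence, h]
  constructor
  · rw [integrable_map_measure hmeas.aestronglyMeasurable hφ.aemeasurable]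
    have : (fun Y : Fin p → Fin N → ℝ => Psihat Φ δ ν (Matrix.of Y) i j) ∘
        (fun Z => Matrix.of.symm (M * Φ) + sandwich A B Z) = fun Z : Fin p → Fin N → ℝ =>
        nuP p ν / N * ∑ l, ∑ k, A i k * A j l * (Matrix.of Z * C * (Matrix.of Z)ᵀ) k l :=
      funext hPsi
    rw [this]
    exact (integrable_finsetSum _ fun l _ => integrable_finsetSum _ fun k _ => hint k l).const_mul _
  · rw [integral_map hφ.aemeasurable hmeas.aestronglyMeasurable]
    simp only [hPsi]
    rw [integral_const_mul, integral_finsetSum _ fun l _ => integrable_finsetSum _ fun k _ =>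
      hint k l]
    have h1 : ∀ l, ∫ Z, ∑ k, A i k * A j l * (Matrix.of Z * C * (Matrix.of Z)ᵀ) k l
        ∂(matrixT (0 : Matrix (Fin p) (Fin N) ℝ) 1 1 (ν - 2 * p)) =
        A i l * A j l * (C.trace / (ν - 2 * p - 2)) := by
      intro l
      rw [integral_finsetSum _ fun k _ => hint k l]
      simp only [integral_const_mul, integral_quadratic_matrixT hκ]
      rw [Finset.sum_eq_single l]
      · rw [one_apply_eq, mul_one]
      · intro k _ hkl
        rw [one_apply_ne hkl, mul_zero, mul_zero]
      · simp
    have htr : C.trace = (N : ℝ) - d := by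
      rw [hC, Matrix.mul_assoc, trace_mul_comm, Matrix.mul_assoc, ← hB,
        trace_precisionProj_mul_Om hΦ hδ]
    have hΨij : Ψ i j = ∑ l, A i l * A j l := by
      rw [hA, Matrix.mul_apply]; rfl
    simp only [h1]
    rw [← Finset.sum_mul, ← hΨij, htr, show nuP p ν - p - 1 = ν - 2 * p - 2 by rw [nuP]; ring]
    ring

end Evidence

end BLL

end

/-! ### The main theorem -/

theorem theorem4p3 (p d N : ℕ) (hp : 0 < p) (hN : max d p ≤ N)
    (Φ : Matrix (Fin d) (Fin N) ℝ) (hΦ : Φ.rank = min d N)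
    (δ : Fin N → ℝ) (hδ : ∀ i, 0 < δ i) (ν : ℝ) (hν : 2 * (p : ℝ) < ν) :
    -- `P` is well defined and is the orthogonal projector onto the kernel of `Φ D^{-1/2}`
    (BLL.IsMoorePenrose (Φ * BLL.noiseInvSqrt δ) (BLL.pinv (Φ * BLL.noiseInvSqrt δ)) ∧
      (BLL.proj Φ δ)ᵀ = BLL.proj Φ δ ∧
      BLL.proj Φ δ * BLL.proj Φ δ = BLL.proj Φ δ ∧
      ∀ v : Fin N → ℝ, BLL.proj Φ δ *ᵥ v = v ↔ (Φ * BLL.noiseInvSqrt δ) *ᵥ v = 0) ∧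
    -- the evidence is a probability law and the loss is its negative log-density
    (∀ (M : Matrix (Fin p) (Fin d) ℝ) (K : Matrix (Fin d) (Fin d) ℝ)
        (Ψ : Matrix (Fin p) (Fin p) ℝ), K.PosDef → Ψ.PosDef →
      IsProbabilityMeasure (BLL.evidence Φ δ ν M K Ψ) ∧
      ∀ Y : Matrix (Fin p) (Fin N) ℝ,
        BLL.loss Φ δ ν Y M K Ψ =
          -Real.log (BLL.matrixTPDF (M * Φ) Ψ (BLL.Om Φ δ K) (ν - 2 * p) Y)) ∧
    -- for all `Y`, `K`, `Ψ`, the unique minimizer in `M` is the same `M̂`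
    (∀ (Y : Matrix (Fin p) (Fin N) ℝ) (K : Matrix (Fin d) (Fin d) ℝ)
        (Ψ : Matrix (Fin p) (Fin p) ℝ), K.PosSemidef → Ψ.PosDef →
      ∀ M : Matrix (Fin p) (Fin d) ℝ, M ≠ BLL.Mhat Φ δ Y →
        BLL.loss Φ δ ν Y (BLL.Mhat Φ δ Y) K Ψ < BLL.loss Φ δ ν Y M K Ψ) ∧
    (∀ Y : Matrix (Fin p) (Fin N) ℝ, (BLL.Psihat Φ δ ν Y).PosDef →
      -- for every `K`, the unique joint minimizer in `(M, Ψ)` is `(M̂, Ψ̂)`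
      (∀ K : Matrix (Fin d) (Fin d) ℝ, K.PosSemidef →
        ∀ (M : Matrix (Fin p) (Fin d) ℝ) (Ψ : Matrix (Fin p) (Fin p) ℝ), Ψ.PosDef →
          (M, Ψ) ≠ (BLL.Mhat Φ δ Y, BLL.Psihat Φ δ ν Y) →
          BLL.loss Φ δ ν Y (BLL.Mhat Φ δ Y) K (BLL.Psihat Φ δ ν Y)
            < BLL.loss Φ δ ν Y M K Ψ) ∧
      -- the joint infimum and the infimum over `K` alone agree, with the value at `K = 0`
      IsGLB {r : ℝ | ∃ (M : Matrix (Fin p) (Fin d) ℝ) (K : Matrix (Fin d) (Fin d) ℝ)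
          (Ψ : Matrix (Fin p) (Fin p) ℝ), K.PosDef ∧ Ψ.PosDef ∧ r = BLL.loss Φ δ ν Y M K Ψ}
        (BLL.loss Φ δ ν Y (BLL.Mhat Φ δ Y) 0 (BLL.Psihat Φ δ ν Y)) ∧
      IsGLB {r : ℝ | ∃ K : Matrix (Fin d) (Fin d) ℝ, K.PosDef ∧
          r = BLL.loss Φ δ ν Y (BLL.Mhat Φ δ Y) K (BLL.Psihat Φ δ ν Y)}
        (BLL.loss Φ δ ν Y (BLL.Mhat Φ δ Y) 0 (BLL.Psihat Φ δ ν Y)) ∧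
      -- with `M̂` and `Ψ̂`, the loss is concave and strictly increasing in `K`
      ConcaveOn ℝ {K : Matrix (Fin d) (Fin d) ℝ | K.PosSemidef}
        (fun K => BLL.loss Φ δ ν Y (BLL.Mhat Φ δ Y) K (BLL.Psihat Φ δ ν Y)) ∧
      (∀ K K' : Matrix (Fin d) (Fin d) ℝ, K'.PosSemidef → (K - K').PosSemidef → K ≠ K' →
        BLL.loss Φ δ ν Y (BLL.Mhat Φ δ Y) K' (BLL.Psihat Φ δ ν Y)
          < BLL.loss Φ δ ν Y (BLL.Mhat Φ δ Y) K (BLL.Psihat Φ δ ν Y)) ∧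
      -- `K̂ = 0` is the unique global minimizer, for `K` alone and jointly with `(M̂, Ψ̂)`
      (∀ K : Matrix (Fin d) (Fin d) ℝ, K.PosSemidef → K ≠ 0 →
        BLL.loss Φ δ ν Y (BLL.Mhat Φ δ Y) 0 (BLL.Psihat Φ δ ν Y)
          < BLL.loss Φ δ ν Y (BLL.Mhat Φ δ Y) K (BLL.Psihat Φ δ ν Y)) ∧
      (∀ (M : Matrix (Fin p) (Fin d) ℝ) (K : Matrix (Fin d) (Fin d) ℝ)
          (Ψ : Matrix (Fin p) (Fin p) ℝ), K.PosSemidef → Ψ.PosDef →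
        (M, K, Ψ) ≠ (BLL.Mhat Φ δ Y, 0, BLL.Psihat Φ δ ν Y) →
        BLL.loss Φ δ ν Y (BLL.Mhat Φ δ Y) 0 (BLL.Psihat Φ δ ν Y)
          < BLL.loss Φ δ ν Y M K Ψ)) ∧
    -- `Ψ̂` is almost surely positive definite as soon as `N ≥ d + p`
    (d + p ≤ N → ∀ (M : Matrix (Fin p) (Fin d) ℝ) (K : Matrix (Fin d) (Fin d) ℝ)
        (Ψ : Matrix (Fin p) (Fin p) ℝ), K.PosDef → Ψ.PosDef →
      ∀ᵐ Y ∂(BLL.evidence Φ δ ν M K Ψ), (BLL.Psihat Φ δ ν (Matrix.of Y)).PosDef) ∧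
    -- the mean of `Ψ̂` under the evidence
    (2 * (p : ℝ) + 2 < ν → ∀ (M : Matrix (Fin p) (Fin d) ℝ) (K : Matrix (Fin d) (Fin d) ℝ)
        (Ψ : Matrix (Fin p) (Fin p) ℝ), K.PosDef → Ψ.PosDef → ∀ i j : Fin p,
      Integrable (fun Y : Fin p → Fin N → ℝ => BLL.Psihat Φ δ ν (Matrix.of Y) i j)
        (BLL.evidence Φ δ ν M K Ψ) ∧
      ∫ Y, BLL.Psihat Φ δ ν (Matrix.of Y) i j ∂(BLL.evidence Φ δ ν M K Ψ) =
        ((N : ℝ) - d) / N * (BLL.nuP p ν / (BLL.nuP p ν - p - 1)) * Ψ i j) := by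
  have hr : Φ.rank = d := by rw [hΦ, min_eq_left ((le_max_left d p).trans hN)]
  have hN0 : 0 < N := hp.trans_le ((le_max_right d p).trans hN)
  refine ⟨⟨BLL.isMoorePenrose_pinv_whitened hr hδ, BLL.transpose_proj hr hδ,
    BLL.proj_mul_proj hr hδ, BLL.proj_mulVec_eq_self_iff hr hδ⟩,
    fun M K Ψ hK hΨ => ⟨BLL.isProbabilityMeasure_evidence hδ hν M hK hΨ,
      BLL.loss_eq_neg_log_matrixTPDF hδ hν M hK hΨ⟩,
    fun Y K Ψ hK hΨ M hM => BLL.loss_Mhat_lt hp hν hr hδ Y hK hΨ hM, fun Y hY => ?_,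
    fun hdp M K Ψ _ _ => BLL.ae_posDef_Psihat hp hr hδ hν hdp M K Ψ,
    fun hν2 M K Ψ hK hΨ i j => BLL.integrable_and_integral_Psihat hr hδ hν2 M hK hΨ i j⟩
  have hglb := BLL.isGLB_loss_Mhat hp hr hδ ν Y (BLL.Psihat Φ δ ν Y)
  have hzero : ∀ K : Matrix (Fin d) (Fin d) ℝ, K.PosSemidef → K ≠ 0 →
      BLL.loss Φ δ ν Y (BLL.Mhat Φ δ Y) 0 (BLL.Psihat Φ δ ν Y)
        < BLL.loss Φ δ ν Y (BLL.Mhat Φ δ Y) K (BLL.Psihat Φ δ ν Y) := fun K hK hne =>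
    BLL.loss_Mhat_lt_of_lt hp hr hδ ν Y _ Matrix.PosSemidef.zero (by simpa using hK) hne
  have hjoint : ∀ (M : Matrix (Fin p) (Fin d) ℝ) (K : Matrix (Fin d) (Fin d) ℝ)
      (Ψ : Matrix (Fin p) (Fin p) ℝ), K.PosSemidef → Ψ.PosDef →
      (M, K, Ψ) ≠ (BLL.Mhat Φ δ Y, 0, BLL.Psihat Φ δ ν Y) →
      BLL.loss Φ δ ν Y (BLL.Mhat Φ δ Y) 0 (BLL.Psihat Φ δ ν Y)
        < BLL.loss Φ δ ν Y M K Ψ := by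
    intro M K Ψ hK hΨ hne
    by_cases h0 : K = 0
    · subst h0
      refine BLL.loss_joint_lt hp hN0 hν hr hδ hY hK hΨ fun h => hne ?_
      rw [Prod.mk.injEq] at h
      rw [h.1, h.2]
    · exact (hzero K hK h0).trans_le (BLL.loss_joint_le hp hN0 hν hr hδ hY M hK hΨ)
  refine ⟨fun K hK M Ψ hΨ hne => BLL.loss_joint_lt hp hN0 hν hr hδ hY hK hΨ hne, ⟨?_, ?_⟩, hglb,
    BLL.concaveOn_loss_Mhat hr hδ ν Y _,
    fun K K' hK' h hne => BLL.loss_Mhat_lt_of_lt hp hr hδ ν Y _ hK' h hne, hzero, hjoint⟩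
  · rintro r ⟨M, K, Ψ, hK, hΨ, rfl⟩
    -- Equality is possible here only for d = 0, where the empty matrix 0 is positive definite.
    by_cases h : (M, K, Ψ) = (BLL.Mhat Φ δ Y, 0, BLL.Psihat Φ δ ν Y)
    · simp only [Prod.mk.injEq] at h
      rw [h.1, h.2.1, h.2.2]
    · exact (hjoint M K Ψ hK.posSemidef hΨ h).le
  · intro b hb
    -- Fixing M = M̂ and Ψ = Ψ̂ selects a subset of the joint values, so a joint lower bound also
    -- bounds the infimum over K alone.
    refine hglb.2 ?_
    rintro r ⟨K, hK, rfl⟩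
    exact hb ⟨_, K, _, hK, hY, rfl⟩
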